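/- Let $h_1,h_2\sim\mathcal{CN}(0,1)$ be independent, let $P>0$, and consider the two-transmitter distributed antenna system $Y=h_1X_1+h_2X_2+Z$, $Z\sim\mathcal{CN}(0,1)$, in which two single-antenna transmitters send a common message, each with power at most $P/2$, and only the receiver knows $h=(h_1,h_2)$. Write $\mathrm E_1(x)=\int_x^\infty \frac{e^{-t}}{t}\,dt$ for $x>0$. Rates are in nats. A continuous-layer code consists of an integrable density $Q(s)\succeq 0$, $s\in(0,\infty)$, of $2\times2$ input covariance matrices and a measurable rate density $r(s)\ge 0$. With $S(s)=\int_s^\infty Q(t)\,dt$ the covariance of the layers above $s$, its power constraint is $S(0)_{11},S(0)_{22}\le P/2$ and its expected-rate is $$\int_0^\infty \Pr\left\{\frac{hQ(s)h^\dagger}{1+hS(s)h^\dagger}\ge r(s)\right\} r(s)\,ds .$$ If $Q(s)=-I'(s)\,\mathbf I_2$ and $r(s)=\frac{-sI'(s)}{1+sI(s)}$, where $I(s)$ is the power per transmitter of the layers above $s$, this is $\int_0^\infty \Pr\{|h_1|^2+|h_2|^2\ge s\}\,\frac{-sI'(s)}{1+sI(s)}\,ds$. Then the maximum continuous-layer expected-rate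 exists and equals $$\mathcal R_c^m = 3\mathrm E_1(s_0)+(1-s_0)e^{-s_0}-3\mathrm E_1(s_1)-(1-s_1)e^{-s_1},$$ both when the maximum is taken over all continuous-layer codes satisfying the power constraint and when it is taken over the layers' power distributions $I(s)=\int_s^\infty\rho(t)\,dt$, with $\rho\ge 0$ integrable and $\int_0^\infty\rho\le P/2$, in the last formula. Here $s_1=\frac{1+\sqrt5}{2}$ and $$s_0=\sqrt[3]{\sqrt{A^2-B^3}+A}+\frac{B}{\sqrt[3]{\sqrt{A^2-B^3}+A}}-\frac{2}{3P},\qquad A=\frac1P-\frac{2}{3P^2}-\frac{8}{27P^3},\quad B=\frac{2}{3P}+\frac{4}{9P^2},$$ where the roots are principal complex roots (for $P\ge2$ they are real roots of nonnegative numbers, for $P<2$ one has $A^2-B^3<0$); $s_0$ is real and $0<s_0<s_1$. The ergodic capacity, i.e. the maximum of $\mathbb E\ln(1+hQh^\dagger)$ over all covariance matrices $Q\succeq0$ with $Q_{11},Q_{22}\le P/2$, is $$C_{\mathrm{erg}}=1+\left(1-\frac2P\right)e^{2/P}\,\mathrm E_1\!\left(\frac2P\right).$$ -/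

import Mathlib

open MeasureTheory ProbabilityTheory Set Matrix
open scoped NNReal ENNReal ComplexConjugate ComplexOrder

noncomputable section

namespace DistributedAntenna

/-- The law `𝒞𝒩(0,1)`: independent real and imaginary parts, each `𝒩(0, 1/2)`. -/
def complexGaussian : Measure ℂ :=
  ((gaussianReal 0 (1 / 2)).prod (gaussianReal 0 (1 / 2))).map
    (fun z : ℝ × ℝ => (⟨z.1, z.2⟩ : ℂ))

/-- The exponential integral `E₁(x) = ∫_x^∞ e^{-t}/t dt` (used for `x > 0`). -/
def E₁ (x : ℝ) : ℝ := ∫ t in Ioi x, Real.exp (-t) / t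

/-- The received power `h Q h†` for the row vector `h` of fading coefficients and the covariance
matrix `Q` of the pair of transmitted signals (it is real, since `Q` is Hermitian). -/
def receivedPower (h : Fin 2 → ℂ) (Q : Matrix (Fin 2) (Fin 2) ℂ) : ℝ :=
  (h ⬝ᵥ (Q *ᵥ star h)).re

/-- The instantaneous mutual information (in nats) `ln (1 + h Q h†)`. -/
def mutualInformation (h : Fin 2 → ℂ) (Q : Matrix (Fin 2) (Fin 2) ℂ) : ℝ :=
  Real.log (1 + receivedPower h Q)

/-- Input covariances of the two-transmitter system in which the `i`-th transmitter, whose power is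
the `i`-th diagonal entry, uses power at most `p`. -/
def IsAdmissibleCov (p : ℝ) (Q : Matrix (Fin 2) (Fin 2) ℂ) : Prop :=
  Q.PosSemidef ∧ ∀ i, (Q i i).re ≤ p

/-- A continuum of superposed code layers, indexed by `s ∈ (0, ∞)` from the lowest layer (decoded
first) upwards. The infinitesimal layer `[s, s + ds]` has input covariance `cov s ds` and rate
`rate s ds`. -/
structure ContinuousLayerCode where
  cov : ℝ → Matrix (Fin 2) (Fin 2) ℂ
  rate : ℝ → ℝ≥0
  cov_posSemidef : ∀ s ∈ Ioi (0 : ℝ), (cov s).PosSemidef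
  cov_integrable : ∀ i j, IntegrableOn (fun s => cov s i j) (Ioi 0)
  rate_measurable : Measurable rate

namespace ContinuousLayerCode

/-- Total covariance of the layers above `s`, i.e. of the interference seen while layer `s` is
being decoded. -/
def upper (c : ContinuousLayerCode) (s : ℝ) : Matrix (Fin 2) (Fin 2) ℂ :=
  Matrix.of fun i j => ∫ t in Ioi s, c.cov t i j

/-- Total power used by the `i`-th transmitter. -/
def power (c : ContinuousLayerCode) (i : Fin 2) : ℝ := (c.upper 0 i i).re

/-- For the fading coefficients `h`, the mutual information `ln (1 + h Q h† / (1 + h S h†))` of the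
infinitesimal layer `Q = cov s ds`, under the interference `S = upper s`, is
`(h (cov s) h† / (1 + h S h†)) ds`. The layer is decodable if this is at least its rate. -/
def Decodable (c : ContinuousLayerCode) (h : Fin 2 → ℂ) (s : ℝ) : Prop :=
  (c.rate s : ℝ) ≤ receivedPower h (c.cov s) / (1 + receivedPower h (c.upper s))

/-- The expected rate `∫ Pr {layer s is decodable} · rate s ds`. -/
def expectedRate (c : ContinuousLayerCode) {Ω : Type*} [MeasurableSpace Ω] (μ : Measure Ω)
    (h : Fin 2 → Ω → ℂ) : ℝ≥0∞ :=
  ∫⁻ s in Ioi (0 : ℝ), μ {ω | c.Decodable (fun i => h i ω) s} * (c.rate s : ℝ≥0∞)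

end ContinuousLayerCode

/-- A distribution of the power of one transmitter over the layers, of total power at most `p`;
here layer `s` is the one designed for the channel gain `s`, and `ρ s` is its power density. -/
def IsPowerDistribution (p : ℝ) (ρ : ℝ → ℝ) : Prop :=
  (∀ s ∈ Ioi (0 : ℝ), 0 ≤ ρ s) ∧ IntegrableOn ρ (Ioi 0) ∧ ∫ s in Ioi (0 : ℝ), ρ s ≤ p

/-- The power `I(s) = ∫_s^∞ ρ` of the layers above `s`; thus `I' = -ρ`. -/
def interference (ρ : ℝ → ℝ) (s : ℝ) : ℝ := ∫ t in Ioi s, ρ t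

/-- The expected rate `∫₀^∞ Pr {a ≥ s} · (-s I'(s)) / (1 + s I(s)) ds` of the layered code with
power distribution `ρ` over a channel with random power gain `a`. -/
def layeredRate {Ω : Type*} [MeasurableSpace Ω] (μ : Measure Ω) (a : Ω → ℝ) (ρ : ℝ → ℝ) : ℝ≥0∞ :=
  ∫⁻ s in Ioi (0 : ℝ), μ {ω | s ≤ a ω} * ENNReal.ofReal (s * ρ s / (1 + s * interference ρ s))

def cardanoA (P : ℝ) : ℝ := 1 / P - 2 / (3 * P ^ 2) - 8 / (27 * P ^ 3)

def cardanoB (P : ℝ) : ℝ := 2 / (3 * P) + 4 / (9 * P ^ 2)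

/-- `∛(√(A² - B³) + A)`. The roots are principal complex roots: `A² - B³ < 0` for `P < 2`;
for `P ≥ 2` they are the ordinary real roots of nonnegative numbers. -/
def cardanoRoot (P : ℝ) : ℂ :=
  ((((cardanoA P ^ 2 - cardanoB P ^ 3 : ℝ) : ℂ) ^ (1 / 2 : ℂ)) + (cardanoA P : ℂ)) ^ (1 / 3 : ℂ)

/-- `∛(√(A² - B³) + A) + B / ∛(√(A² - B³) + A) - 2 / (3P)`. -/
def cardanoS₀ (P : ℝ) : ℂ :=
  cardanoRoot P + (cardanoB P : ℂ) / cardanoRoot P - 2 / (3 * (P : ℂ))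

/-- `3 E₁(s₀) + (1 - s₀) e^{-s₀} - 3 E₁(s₁) - (1 - s₁) e^{-s₁}`. -/
def rateFormula (s₀ s₁ : ℝ) : ℝ :=
  3 * E₁ s₀ + (1 - s₀) * Real.exp (-s₀) - 3 * E₁ s₁ - (1 - s₁) * Real.exp (-s₁)

end DistributedAntenna

end

namespace DistributedAntenna

/-! ### The tangent bound for the tail of the channel gain -/

/-! The upper bound prices power. For `l > 0`, the probability that `l(|h₁|² + |h₂|²) ≥ 1` is `G(l)
= (1 + 1/l)e^{-1/l}`. For `0 < s ≤ (1+√5)/2` this function lies below its tangent at `1/s`, that is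
`G(l) ≤ w(s)(2l + T(s))` with `w = marginalRate` and `T = thresholdPower` (`tail_le_tangent`,
`gainTail_le`).

Consider a layer with covariance `Q`, rate `r > 0` and interference `S`. It is decodable iff `h(Q -
rS)h† ≥ r`. Unitary invariance of the law of `h` diagonalizes `Q - rS`, so the event becomes `a|h₁|²
+ b|h₂|² ≥ 1` with `ra`, `rb` the eigenvalues. Given the sum of the two gains, their proportion `u`
is uniform, so the probability is the average of `G(b + u(a - b))` over `u`, with `G` extended by
zero. If `tr S = T(s)`, then `a, b ≥ -T(s)`, and averaging the tangent gives at most `w(s)(a + b +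
T(s))`. Multiplying by `r` gives exactly `w(s) tr Q` (`fadingLaw_decodable_mul_le`). Hence, at
interference power `x = T(s)`, a unit of power earns at most `w(s)`, whatever its direction or rate.

Interference power as the integration variable turns the total into at most the integral of
`w(T⁻¹(x))` over `0 ≤ x ≤ P` (`map_interference`, `lintegral_le_rateFormula`). The substitution `x =
T(s)` makes it the integral of `e^{-s}(3/s + 2 - s)` from `s₀` to `s₁`, where `T(s₀) = P` and `T(s₁)
= 0`. The isotropic code with `I = T/2` on `[s₀, s₁]` attains it. The equation `T(s₀) = P` is a
cubic, solved by Cardano's formula.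

For the ergodic capacity, averaging over sign flip and swap together with concavity of the logarithm
makes isotropic inputs optimal; their rate follows from the layer-cake formula. -/

lemma hasDerivAt_poly_mul_exp_neg (x : ℝ) :
    HasDerivAt (fun x : ℝ => (1 + x - x ^ 2) * Real.exp (-x))
      (x * (x - 3) * Real.exp (-x)) x := by
  have h1 : HasDerivAt (fun x : ℝ => 1 + x - x ^ 2) (1 - 2 * x) x := by
    simpa using ((hasDerivAt_id x).const_add 1).fun_sub (hasDerivAt_pow 2 x)
  have h2 : HasDerivAt (fun x : ℝ => Real.exp (-x)) (-Real.exp (-x)) x := by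
    simpa using (hasDerivAt_neg x).exp
  exact (h1.fun_mul h2).congr_deriv (by ring)

/-- The function is the derivative of `x(1 + x)e^{-x}`, so its monotonicity determines on which side
of the tangent that product lies. -/
lemma antitoneOn_poly_mul_exp_neg :
    AntitoneOn (fun x : ℝ => (1 + x - x ^ 2) * Real.exp (-x)) (Icc 0 3) := by
  apply antitoneOn_of_deriv_nonpos (convex_Icc 0 3)
  · exact fun x _ => (hasDerivAt_poly_mul_exp_neg x).continuousAt.continuousWithinAt
  · exact fun x _ => (hasDerivAt_poly_mul_exp_neg x).differentiableAt.differentiableWithinAt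
  · intro x hx
    rw [interior_Icc] at hx
    rw [(hasDerivAt_poly_mul_exp_neg x).deriv]
    exact mul_nonpos_of_nonpos_of_nonneg
      (mul_nonpos_of_nonneg_of_nonpos hx.1.le (by linarith [hx.2])) (Real.exp_pos _).le

/-- The function `λ ↦ (1 + 1/λ) e^{-1/λ}` lies below its tangent line at `1/s`. -/
lemma tail_le_tangent {x s : ℝ} (hx : 0 < x) (hs : 0 < s) (hs' : s ^ 2 ≤ 1 + s) :
    (1 + x) * Real.exp (-x) ≤ Real.exp (-s) * (1 + s - s ^ 2 + s ^ 3 / x) := by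
  set k : ℝ → ℝ := fun x => (1 + x - x ^ 2) * Real.exp (-x) with hk
  have hs3 : s ≤ 3 := by nlinarith
  -- `ψ` is `x` times the gap in the claim; clearing the division makes its derivative `k s - k x`,
  -- so `ψ` is smallest at `s`, where it vanishes.
  set ψ : ℝ → ℝ := fun x =>
    Real.exp (-s) * (x * (1 + s - s ^ 2) + s ^ 3) - (x + x ^ 2) * Real.exp (-x) with hψ
  have hd : ∀ x, HasDerivAt ψ (k s - k x) x := by
    intro x
    have h1 : HasDerivAt (fun x : ℝ => x + x ^ 2) (1 + 2 * x) x := by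
      simpa using (hasDerivAt_id' x).fun_add (hasDerivAt_pow 2 x)
    have h2 : HasDerivAt (fun x : ℝ => Real.exp (-x)) (-Real.exp (-x)) x := by
      simpa using (hasDerivAt_neg x).exp
    have h3 : HasDerivAt (fun x : ℝ => Real.exp (-s) * (x * (1 + s - s ^ 2) + s ^ 3))
        (Real.exp (-s) * (1 * (1 + s - s ^ 2))) x :=
      (((hasDerivAt_id x).mul_const _).add_const _).const_mul _
    exact (h3.fun_sub (h1.fun_mul h2)).congr_deriv (by simp only [hk]; ring)
  have hψs : ψ s = 0 := by simp only [hψ]; ring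
  have hψc : Continuous ψ := continuous_iff_continuousAt.2 fun x => (hd x).continuousAt
  have hks : 0 ≤ k s := mul_nonneg (by linarith) (Real.exp_pos _).le
  have hψx : 0 ≤ ψ x := by
    rcases le_total x s with hxs | hxs
    · have : AntitoneOn ψ (Icc 0 s) := by
        apply antitoneOn_of_deriv_nonpos (convex_Icc 0 s) hψc.continuousOn
          (fun x _ => (hd x).differentiableAt.differentiableWithinAt)
        intro y hy
        rw [interior_Icc] at hy
        rw [(hd y).deriv, sub_nonpos]
        exact antitoneOn_poly_mul_exp_neg ⟨hy.1.le, by linarith [hy.2]⟩ ⟨hs.le, hs3⟩ hy.2.le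
      rw [← hψs]
      exact this ⟨hx.le, hxs⟩ ⟨hs.le, le_rfl⟩ hxs
    · have : MonotoneOn ψ (Ici s) := by
        apply monotoneOn_of_deriv_nonneg (convex_Ici s) hψc.continuousOn
          (fun x _ => (hd x).differentiableAt.differentiableWithinAt)
        intro y hy
        rw [interior_Ici] at hy
        rw [(hd y).deriv, sub_nonneg]
        rcases le_total y 3 with h3 | h3
        · exact antitoneOn_poly_mul_exp_neg ⟨hs.le, hs3⟩ ⟨(hs.trans hy).le, h3⟩ (le_of_lt hy)
        -- Beyond `3`, `k` is no longer antitone but is nonpositive, while `k s ≥ 0` because `s² ≤ 1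
        -- + s`.
        · exact (mul_nonpos_of_nonpos_of_nonneg (by nlinarith) (Real.exp_pos _).le).trans hks
      rw [← hψs]
      exact this self_mem_Ici hxs hxs
  have : Real.exp (-s) * (1 + s - s ^ 2 + s ^ 3 / x) - (1 + x) * Real.exp (-x) = ψ x / x := by
    simp only [hψ]
    field_simp
  have h4 := div_nonneg hψx hx.le
  linarith

/-! ### The cubic equation for `s₀` -/

/-- The factorization shows that the sign is that of `P - 2`, which separates the real from the
complex case of the formula. -/
lemma cardano_discriminant {P : ℝ} (hP : 0 < P) :
    cardanoA P ^ 2 - cardanoB P ^ 3 = (P - 2) * (27 * P + 10) / (27 * P ^ 4) := by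
  unfold cardanoA cardanoB
  field_simp
  ring

lemma cardanoB_pos {P : ℝ} (hP : 0 < P) : 0 < cardanoB P := by
  unfold cardanoB
  positivity

lemma cardanoA_pos {P : ℝ} (hP : 2 ≤ P) : 0 < cardanoA P := by
  have h : cardanoA P = (27 * P ^ 2 - 18 * P - 8) / (27 * P ^ 3) := by
    unfold cardanoA
    field_simp
    ring
  rw [h]
  have : 0 < 27 * P ^ 2 - 18 * P - 8 := by nlinarith
  positivity

lemma cardanoRoot_pow_three (P : ℝ) :
    cardanoRoot P ^ 3 =
      ((cardanoA P ^ 2 - cardanoB P ^ 3 : ℝ) : ℂ) ^ (1 / 2 : ℂ) + (cardanoA P : ℂ) := by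
  unfold cardanoRoot
  rw [show (1 / 3 : ℂ) = ((3 : ℕ) : ℂ)⁻¹ by norm_num]
  exact Complex.cpow_nat_inv_pow _ (by norm_num)

/-- A zero root would force the square root to equal `-A`, hence `A² - B³ = A²`, against `B > 0`. -/
lemma cardanoRoot_ne_zero {P : ℝ} (hP : 0 < P) : cardanoRoot P ≠ 0 := by
  intro h0
  have h1 := cardanoRoot_pow_three P
  set D := cardanoA P ^ 2 - cardanoB P ^ 3 with hD
  have h2 : ((D : ℂ) ^ (1 / 2 : ℂ)) ^ 2 = D := by
    rw [show (1 / 2 : ℂ) = ((2 : ℕ) : ℂ)⁻¹ by norm_num]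
    exact Complex.cpow_nat_inv_pow _ (by norm_num)
  rw [h0, zero_pow (by norm_num)] at h1
  have h3 : (D : ℂ) ^ (1 / 2 : ℂ) = -(cardanoA P : ℂ) := by linear_combination -h1
  rw [h3] at h2
  have h4 : cardanoA P ^ 2 = D := by
    have : ((cardanoA P ^ 2 : ℝ) : ℂ) = D := by push_cast; linear_combination h2
    exact_mod_cast this
  have := pow_pos (cardanoB_pos hP) 3
  linarith

/-- For nonnegative discriminant, the principal roots are the real ones. -/
lemma exists_real_cardano_sum_of_two_le {P : ℝ} (hP : 2 ≤ P) :
    ∃ y : ℝ, (y : ℂ) = cardanoRoot P + (cardanoB P : ℂ) / cardanoRoot P ∧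
      √(cardanoB P) ≤ y := by
  have hP0 : 0 < P := by linarith
  have hD : 0 ≤ cardanoA P ^ 2 - cardanoB P ^ 3 := by
    rw [cardano_discriminant hP0]
    have : 0 ≤ P - 2 := by linarith
    positivity
  have hA := cardanoA_pos hP
  have hB := cardanoB_pos hP0
  set r : ℝ := ((cardanoA P ^ 2 - cardanoB P ^ 3) ^ (1 / 2 : ℝ) + cardanoA P) ^ (1 / 3 : ℝ) with hr
  have hz : 0 < (cardanoA P ^ 2 - cardanoB P ^ 3) ^ (1 / 2 : ℝ) + cardanoA P := by positivity
  have hrpos : 0 < r := Real.rpow_pos_of_pos hz _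
  have hroot : cardanoRoot P = r := by
    unfold cardanoRoot
    rw [hr, Complex.ofReal_cpow hz.le, Complex.ofReal_add, Complex.ofReal_cpow hD]
    norm_num
  refine ⟨r + cardanoB P / r, by rw [hroot]; push_cast; rfl, ?_⟩
  have hsq : √(cardanoB P) ^ 2 = cardanoB P := Real.sq_sqrt hB.le
  have hq : 0 ≤ √(cardanoB P) := Real.sqrt_nonneg _
  rw [show r + cardanoB P / r = (r ^ 2 + cardanoB P) / r by field_simp, le_div_iff₀ hrpos]
  nlinarith [sq_nonneg (r - √(cardanoB P))]

/-- For negative discriminant, the two summands are complex conjugates. -/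
lemma exists_real_cardano_sum_of_lt_two {P : ℝ} (hP : 0 < P) (hP2 : P < 2) :
    ∃ y : ℝ, (y : ℂ) = cardanoRoot P + (cardanoB P : ℂ) / cardanoRoot P ∧
      √(cardanoB P) ≤ y := by
  have hB := cardanoB_pos hP
  set D := cardanoA P ^ 2 - cardanoB P ^ 3 with hDdef
  have hD : D < 0 := by
    rw [hDdef, cardano_discriminant hP]
    exact div_neg_of_neg_of_pos (mul_neg_of_neg_of_pos (by linarith) (by linarith)) (by positivity)
  have hsqrt : ((D : ℂ) ^ (1 / 2 : ℂ)) = (√(-D) : ℝ) * Complex.I := by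
    rw [Complex.ofReal_cpow_of_nonpos hD.le, ← Complex.ofReal_neg, Real.sqrt_eq_rpow,
      Complex.ofReal_cpow (by linarith)]
    congr 1
    · norm_num
    · rw [show (Real.pi : ℂ) * Complex.I * (1 / 2) = Real.pi / 2 * Complex.I by ring,
        Complex.exp_pi_div_two_mul_I]
  set z : ℂ := (D : ℂ) ^ (1 / 2 : ℂ) + (cardanoA P : ℂ) with hz
  have hc3 : cardanoRoot P ^ 3 = z := cardanoRoot_pow_three P
  have hc0 := cardanoRoot_ne_zero hP
  have hz0 : z ≠ 0 := hc3 ▸ pow_ne_zero 3 hc0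
  have hnz : Complex.normSq z = cardanoB P ^ 3 := by
    rw [hz, hsqrt, Complex.normSq_apply]
    simp only [Complex.add_re, Complex.mul_re, Complex.ofReal_re, Complex.I_re, mul_zero,
      Complex.ofReal_im, Complex.I_im, mul_one, sub_self, zero_add, Complex.add_im, Complex.mul_im,
      add_zero]
    rw [Real.mul_self_sqrt (by linarith)]
    simp only [hDdef]
    ring
  -- `|c|² = B` is what makes `B / c` the conjugate of the root `c`.
  have hnc : Complex.normSq (cardanoRoot P) = cardanoB P := by
    have : Complex.normSq (cardanoRoot P) ^ 3 = cardanoB P ^ 3 := by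
      rw [← map_pow, hc3, hnz]
    exact (pow_left_inj₀ (Complex.normSq_nonneg _) hB.le (by norm_num)).1 this
  have hnorm : ‖cardanoRoot P‖ = √(cardanoB P) := by
    rw [← hnc]; rfl
  have harg : Complex.arg (cardanoRoot P) = Complex.arg z / 3 := by
    have : cardanoRoot P = z ^ (1 / 3 : ℂ) := rfl
    rw [this, Complex.cpow_def_of_ne_zero hz0, Complex.arg_exp]
    have him : (Complex.log z * (1 / 3)).im = Complex.arg z / 3 := by
      rw [show (1 / 3 : ℂ) = ((1 / 3 : ℝ) : ℂ) by norm_num, Complex.im_mul_ofReal, Complex.log_im]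
      ring
    rw [him, toIocMod_eq_self]
    have h1 := Complex.neg_pi_lt_arg z
    have h2 := Complex.arg_le_pi z
    have := Real.pi_pos
    constructor <;> linarith
  -- The principal cube root has argument in `[-π/3, π/3]`; this selects the positive one among the
  -- three real roots.
  have hcos : 1 / 2 ≤ Real.cos (Complex.arg (cardanoRoot P)) := by
    rw [← Real.cos_pi_div_three, ← Real.cos_abs (Complex.arg _)]
    have h := Complex.abs_arg_le_pi z
    apply Real.cos_le_cos_of_nonneg_of_le_pi (abs_nonneg _) (by linarith [Real.pi_pos])
    rw [harg, abs_div, abs_of_pos (by norm_num : (0 : ℝ) < 3)]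
    linarith
  have hre : (cardanoRoot P).re = √(cardanoB P) * Real.cos (Complex.arg (cardanoRoot P)) := by
    rw [← hnorm, Complex.norm_mul_cos_arg]
  refine ⟨2 * (cardanoRoot P).re, ?_, ?_⟩
  · have : (cardanoB P : ℂ) / cardanoRoot P = conj (cardanoRoot P) := by
      rw [div_eq_iff hc0, ← Complex.normSq_eq_conj_mul_self, hnc]
    rw [this, Complex.add_conj]
  · rw [hre]
    nlinarith [Real.sqrt_nonneg (cardanoB P)]

/-- The number given by the formula is real and is the positive root of the cubic equation. -/
lemma exists_real_cardanoS₀ {P : ℝ} (hP : 0 < P) :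
    ∃ s : ℝ, (s : ℂ) = cardanoS₀ P ∧ 0 < s ∧ P * s ^ 3 = 2 * (1 + s - s ^ 2) := by
  obtain ⟨y, hy, hyB⟩ : ∃ y : ℝ, (y : ℂ) = cardanoRoot P + (cardanoB P : ℂ) / cardanoRoot P ∧
      √(cardanoB P) ≤ y := by
    rcases lt_or_ge P 2 with h | h
    · exact exists_real_cardano_sum_of_lt_two hP h
    · exact exists_real_cardano_sum_of_two_le h
  have hP' : (P : ℂ) ≠ 0 := by exact_mod_cast hP.ne'
  refine ⟨y - 2 / (3 * P), ?_, ?_, ?_⟩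
  · rw [cardanoS₀, ← hy]
    push_cast
    rfl
  -- `B` exceeds `(2/(3P))²` by `2/(3P)`, so the bound `√B ≤ y` survives the shift with a positive
  -- result.
  · have : 2 / (3 * P) < √(cardanoB P) := by
      apply Real.lt_sqrt_of_sq_lt
      unfold cardanoB
      have : (2 / (3 * P)) ^ 2 = 4 / (9 * P ^ 2) := by field_simp; norm_num
      rw [this]
      have : 0 < 2 / (3 * P) := by positivity
      linarith
    linarith
  · have hc0 := cardanoRoot_ne_zero hP
    have hc3 := cardanoRoot_pow_three P
    have hsq : (((cardanoA P ^ 2 - cardanoB P ^ 3 : ℝ) : ℂ) ^ (1 / 2 : ℂ)) ^ 2 =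
        (cardanoA P : ℂ) ^ 2 - (cardanoB P : ℂ) ^ 3 := by
      rw [show (1 / 2 : ℂ) = ((2 : ℕ) : ℂ)⁻¹ by norm_num, Complex.cpow_nat_inv_pow _ (by norm_num)]
      push_cast
      rfl
    set q := ((cardanoA P ^ 2 - cardanoB P ^ 3 : ℝ) : ℂ) ^ (1 / 2 : ℂ)
    set c := cardanoRoot P
    set a : ℂ := (cardanoA P : ℂ) with ha
    set b : ℂ := (cardanoB P : ℂ) with hb
    -- `y³ - 3By - 2A = 0` is the depressed form of `P s³ + 2s² - 2s - 2 = 0` under `y = s +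
    -- 2/(3P)`. Cardano: `c³` solves `X² - 2AX + B³ = 0`.
    have hcub : (c ^ 3 * ((c + b / c) ^ 3 - 3 * b * (c + b / c) - 2 * a)) = 0 := by
      have : c ^ 3 * ((c + b / c) ^ 3 - 3 * b * (c + b / c) - 2 * a) =
          (c ^ 3) ^ 2 + b ^ 3 - 2 * a * c ^ 3 := by
        field_simp
        ring
      rw [this, hc3]
      linear_combination hsq
    have hcub' := (mul_eq_zero.1 hcub).resolve_left (pow_ne_zero 3 hc0)
    rw [← hy, ha, hb] at hcub'
    have hreal : y ^ 3 - 3 * cardanoB P * y - 2 * cardanoA P = 0 := by exact_mod_cast hcub'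
    unfold cardanoA cardanoB at hreal
    field_simp at hreal ⊢
    linear_combination hreal / 27

/-! ### The complex Gaussian law -/

lemma map_withDensity_comp {α β : Type*} [MeasurableSpace α] [MeasurableSpace β] {μ : Measure α}
    {ν : Measure β} (e : α ≃ᵐ β) (he : MeasurePreserving e μ ν) (f : β → ℝ≥0∞) :
    (μ.withDensity (f ∘ e)).map e = ν.withDensity f := by
  ext s hs
  rw [Measure.map_apply e.measurable hs, withDensity_apply _ (e.measurable hs),
    withDensity_apply _ hs, ← he.setLIntegral_comp_preimage_emb e.measurableEmbedding]
  rfl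

/-- The density of the law `𝒞𝒩(0,1)`. -/
noncomputable def gaussianDensity (z : ℂ) : ℝ≥0∞ :=
  ENNReal.ofReal (Real.pi⁻¹ * Real.exp (-‖z‖ ^ 2))

lemma measurable_gaussianDensity : Measurable gaussianDensity := by
  unfold gaussianDensity
  fun_prop

lemma complexGaussian_eq_withDensity :
    complexGaussian = volume.withDensity gaussianDensity := by
  have hv : (1 / 2 : ℝ≥0) ≠ 0 := by norm_num
  rw [complexGaussian, gaussianReal_of_var_ne_zero _ hv,
    prod_withDensity (measurable_gaussianPDF _ _) (measurable_gaussianPDF _ _),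
    ← map_withDensity_comp _ Complex.volume_preserving_equiv_real_prod.symm]
  have hd : (fun z : ℝ × ℝ => gaussianPDF 0 (1 / 2) z.1 * gaussianPDF 0 (1 / 2) z.2) =
      gaussianDensity ∘ Complex.measurableEquivRealProd.symm := by
    funext z
    have hz : ‖Complex.measurableEquivRealProd.symm z‖ ^ 2 = z.1 ^ 2 + z.2 ^ 2 := by
      rw [← Complex.normSq_eq_norm_sq, Complex.normSq_apply]
      simp [Complex.measurableEquivRealProd]
      ring
    simp only [Function.comp, gaussianDensity, hz, gaussianPDF]
    rw [← ENNReal.ofReal_mul (gaussianPDFReal_nonneg _ _ _)]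
    congr 1
    simp only [gaussianPDFReal, sub_zero]
    have h2 : (2 : ℝ) * ((1 / 2 : ℝ≥0) : ℝ) = 1 := by norm_num
    have h3 : 2 * Real.pi * ((1 / 2 : ℝ≥0) : ℝ) = Real.pi := by push_cast; ring
    rw [h2, h3, mul_mul_mul_comm, ← Real.exp_add, ← mul_inv, Real.mul_self_sqrt Real.pi_pos.le]
    congr 2
    ring
  rw [hd]
  rfl

instance : IsProbabilityMeasure complexGaussian := by
  unfold complexGaussian
  apply Measure.isProbabilityMeasure_map
  have : (fun z : ℝ × ℝ => (⟨z.1, z.2⟩ : ℂ)) = Complex.measurableEquivRealProd.symm := rfl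
  rw [this]
  exact Complex.measurableEquivRealProd.symm.measurable.aemeasurable

/-- The joint law of the two fading coefficients. -/
noncomputable def fadingLaw : Measure (Fin 2 → ℂ) := Measure.pi fun _ => complexGaussian

instance : IsProbabilityMeasure fadingLaw := by
  unfold fadingLaw
  infer_instance

lemma fadingLaw_eq_withDensity :
    fadingLaw = volume.withDensity (fun z => gaussianDensity (z 0) * gaussianDensity (z 1)) := by
  have h1 : fadingLaw = (complexGaussian.prod complexGaussian).map
      (MeasurableEquiv.piFinTwo fun _ => ℂ).symm :=
    ((measurePreserving_piFinTwo fun _ : Fin 2 => complexGaussian).symm _).map_eq.symm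
  rw [h1, complexGaussian_eq_withDensity,
    prod_withDensity measurable_gaussianDensity measurable_gaussianDensity,
    ← map_withDensity_comp _ ((volume_preserving_piFinTwo fun _ => ℂ).symm _)]
  rfl

lemma norm_sq_vecMul_of_mem_unitary {V : Matrix (Fin 2) (Fin 2) ℂ} (hV : V * Vᴴ = 1)
    (z : Fin 2 → ℂ) : ‖(z ᵥ* V) 0‖ ^ 2 + ‖(z ᵥ* V) 1‖ ^ 2 = ‖z 0‖ ^ 2 + ‖z 1‖ ^ 2 := by
  have h : ∀ z : Fin 2 → ℂ, ((‖z 0‖ ^ 2 + ‖z 1‖ ^ 2 : ℝ) : ℂ) = z ⬝ᵥ star z := by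
    intro z
    simp [dotProduct, Fin.sum_univ_two, Complex.mul_conj']
  have h2 : (z ᵥ* V) ⬝ᵥ star (z ᵥ* V) = z ⬝ᵥ star z := by
    rw [star_vecMul, ← dotProduct_mulVec, mulVec_mulVec, hV, one_mulVec]
  rw [← h, ← h] at h2
  exact_mod_cast h2

/-- The joint law of the fading coefficients is unitarily invariant. -/
lemma map_vecMul_fadingLaw {V : Matrix (Fin 2) (Fin 2) ℂ} (hV : V * Vᴴ = 1) :
    fadingLaw.map (fun z => z ᵥ* V) = fadingLaw := by
  have hV' : Vᴴ * V = 1 := mul_eq_one_comm.1 hV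
  let L : (Fin 2 → ℂ) ≃ₗ[ℝ] (Fin 2 → ℂ) :=
    { toFun := fun z => z ᵥ* V
      invFun := fun z => z ᵥ* Vᴴ
      map_add' := fun x y => add_vecMul _ _ _
      map_smul' := fun c x => smul_vecMul _ _ _
      left_inv := fun z => by simp [vecMul_vecMul, hV]
      right_inv := fun z => by simp [vecMul_vecMul, hV'] }
  let e : (Fin 2 → ℂ) ≃ᵐ (Fin 2 → ℂ) := L.toContinuousLinearEquiv.toHomeomorph.toMeasurableEquiv
  set c : ℝ≥0∞ := ENNReal.ofReal |(LinearMap.det (L : (Fin 2 → ℂ) →ₗ[ℝ] (Fin 2 → ℂ)))⁻¹|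
  have he : MeasurePreserving e volume (c • volume) :=
    ⟨e.measurable, Measure.map_linearMap_addHaar_eq_smul_addHaar volume L.isUnit_det'.ne_zero⟩
  -- The joint density depends only on the norm, which `e` preserves, so only the factor by which
  -- `e` scales Lebesgue measure remains.
  have hmap : fadingLaw.map e = c • fadingLaw := by
    have hd : (fun z : Fin 2 → ℂ => gaussianDensity (z 0) * gaussianDensity (z 1)) =
        (fun z => gaussianDensity (z 0) * gaussianDensity (z 1)) ∘ e := by
      funext z
      have hn : ‖(e z) 0‖ ^ 2 + ‖(e z) 1‖ ^ 2 = ‖z 0‖ ^ 2 + ‖z 1‖ ^ 2 :=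
        norm_sq_vecMul_of_mem_unitary hV z
      have hg : ∀ z : Fin 2 → ℂ, gaussianDensity (z 0) * gaussianDensity (z 1) =
          ENNReal.ofReal (Real.pi⁻¹ * Real.pi⁻¹ * Real.exp (-(‖z 0‖ ^ 2 + ‖z 1‖ ^ 2))) := by
        intro z
        unfold gaussianDensity
        rw [← ENNReal.ofReal_mul (by positivity), mul_mul_mul_comm, ← Real.exp_add]
        congr 3
        ring
      rw [Function.comp, hg, hg (e z), hn]
    conv_lhs => rw [fadingLaw_eq_withDensity, hd]
    rw [map_withDensity_comp e he, withDensity_smul_measure, ← fadingLaw_eq_withDensity]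
  -- Comparing total masses replaces computing the determinant.
  have hc : c = 1 := by
    have : (fadingLaw.map e) univ = 1 := by
      rw [Measure.map_apply e.measurable MeasurableSet.univ, preimage_univ, measure_univ]
    rw [hmap] at this
    simpa using this
  rw [hc, one_smul] at hmap
  exact hmap

/-! ### The law of the power gains -/

/-- The standard exponential law. -/
noncomputable def stdExp : Measure ℝ :=
  (volume.restrict (Ioi 0)).withDensity fun x => ENNReal.ofReal (Real.exp (-x))

/-- Polar coordinates followed by `x = r²`: the angle contributes `2π`, which cancels the density's
`π⁻¹` and the Jacobian `2r`. -/
lemma lintegral_normSq_complexGaussian {f : ℝ → ℝ≥0∞} (hf : Measurable f) :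
    ∫⁻ z, f (‖z‖ ^ 2) ∂complexGaussian =
      ∫⁻ x in Ioi (0 : ℝ), ENNReal.ofReal (Real.exp (-x)) * f x := by
  have hf2 : Measurable fun z : ℂ => f (‖z‖ ^ 2) := hf.comp (by fun_prop)
  rw [complexGaussian_eq_withDensity,
    lintegral_withDensity_eq_lintegral_mul _ measurable_gaussianDensity hf2,
    ← Complex.lintegral_comp_polarCoord_symm]
  have h1 : ∀ p ∈ polarCoord.target, ENNReal.ofReal p.1 •
      (gaussianDensity * fun z : ℂ => f (‖z‖ ^ 2)) (Complex.polarCoord.symm p) =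
      ENNReal.ofReal (p.1 * (Real.pi⁻¹ * Real.exp (-p.1 ^ 2))) * f (p.1 ^ 2) := by
    intro p hp
    have hp0 : 0 < p.1 := (by simpa [polarCoord_target] using hp : 0 < p.1 ∧ _).1
    simp only [Pi.mul_apply, gaussianDensity, smul_eq_mul, Complex.norm_polarCoord_symm, sq_abs]
    rw [← mul_assoc, ← ENNReal.ofReal_mul hp0.le]
  have hm : Measurable fun r : ℝ =>
      ENNReal.ofReal (r * (Real.pi⁻¹ * Real.exp (-r ^ 2))) * f (r ^ 2) := by
    apply Measurable.mul (by fun_prop) (hf.comp (by fun_prop))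
  rw [setLIntegral_congr_fun polarCoord.open_target.measurableSet h1, polarCoord_target,
    Measure.volume_eq_prod, ← Measure.prod_restrict,
    lintegral_prod (fun p : ℝ × ℝ => ENNReal.ofReal (p.1 * (Real.pi⁻¹ * Real.exp (-p.1 ^ 2))) *
      f (p.1 ^ 2)) (hm.comp measurable_fst).aemeasurable]
  simp only [lintegral_const, Measure.restrict_apply MeasurableSet.univ, univ_inter,
    Real.volume_Ioo]
  have himg : (fun r : ℝ => r ^ 2) '' Ioi 0 = Ioi 0 := by
    ext x
    simp only [mem_image, mem_Ioi]
    exact ⟨fun ⟨r, hr, h⟩ => h ▸ pow_pos hr 2, fun hx => ⟨√x, Real.sqrt_pos.2 hx, Real.sq_sqrt hx.le⟩⟩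
  have hcv := lintegral_image_eq_lintegral_abs_deriv_mul (s := Ioi (0 : ℝ))
    (f := fun r : ℝ => r ^ 2) (f' := fun r => 2 * r) measurableSet_Ioi
    (fun x _ => by simpa using (hasDerivAt_pow 2 x).hasDerivWithinAt)
    (fun x hx y hy h => (pow_left_inj₀ (le_of_lt hx) (le_of_lt hy) (by norm_num)).1 h)
    (fun x => ENNReal.ofReal (Real.exp (-x)) * f x)
  rw [himg] at hcv
  rw [hcv]
  refine setLIntegral_congr_fun measurableSet_Ioi fun r hr => ?_
  have hr0 : (0 : ℝ) < r := hr
  have hpi := Real.pi_pos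
  rw [mul_right_comm, ← ENNReal.ofReal_mul (by positivity), ← mul_assoc (ENNReal.ofReal |2 * r|),
    ← ENNReal.ofReal_mul (by positivity), abs_of_pos (by positivity)]
  congr 2
  field_simp
  ring

instance : SFinite stdExp := by
  unfold stdExp
  infer_instance

lemma map_normSq_complexGaussian : complexGaussian.map (fun z => ‖z‖ ^ 2) = stdExp := by
  ext s hs
  have hm : Measurable fun z : ℂ => ‖z‖ ^ 2 := by fun_prop
  rw [← lintegral_indicator_one hs, lintegral_map (measurable_one.indicator hs) hm,
    lintegral_normSq_complexGaussian (measurable_one.indicator hs), stdExp,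
    withDensity_apply _ hs, ← lintegral_indicator hs]
  refine lintegral_congr fun x => ?_
  by_cases hx : x ∈ s <;> simp [hx]

instance : IsProbabilityMeasure stdExp := by
  rw [← map_normSq_complexGaussian]
  exact Measure.isProbabilityMeasure_map (by fun_prop)

lemma map_powerGains_fadingLaw :
    fadingLaw.map (fun z => (‖z 0‖ ^ 2, ‖z 1‖ ^ 2)) = stdExp.prod stdExp := by
  have h1 : fadingLaw.map (fun (z : Fin 2 → ℂ) i => ‖z i‖ ^ 2) = Measure.pi fun _ => stdExp := by
    have : ∀ _ : Fin 2, SigmaFinite (complexGaussian.map (fun z => ‖z‖ ^ 2)) := by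
      intro _
      rw [map_normSq_complexGaussian]
      infer_instance
    rw [← map_normSq_complexGaussian, fadingLaw]
    exact Measure.pi_map_pi (f := fun _ z => ‖z‖ ^ 2) (fun _ => by fun_prop)
  rw [← (measurePreserving_piFinTwo fun _ : Fin 2 => stdExp).map_eq, ← h1,
    Measure.map_map (MeasurableEquiv.measurable _) (by fun_prop)]
  rfl

lemma lintegral_comp_mul_left_of_pos {R : ℝ} (hR : 0 < R) (f : ℝ → ℝ≥0∞) :
    ∫⁻ x, f x = ∫⁻ u, ENNReal.ofReal R * f (R * u) := by
  have := lintegral_image_eq_lintegral_abs_deriv_mul (s := univ) (f := fun u => R * u)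
    (f' := fun _ => R) MeasurableSet.univ
    (fun x _ => by simpa using (hasDerivAt_id x).const_mul R)
    (fun x _ y _ h => mul_left_cancel₀ hR.ne' h) f
  rw [image_univ, (mul_left_surjective₀ hR.ne').range_eq, abs_of_pos hR] at this
  simpa using this

/-- The sum of two independent exponential variables is independent of their proportion, which is
uniform. -/
lemma lintegral_stdExp_prod {F : ℝ × ℝ → ℝ≥0∞} (hF : Measurable F) :
    ∫⁻ p, F p ∂(stdExp.prod stdExp) = ∫⁻ u in Ioo (0 : ℝ) 1, ∫⁻ R in Ioi (0 : ℝ),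
      ENNReal.ofReal (R * Real.exp (-R)) * F (R * u, R * (1 - u)) := by
  set A : Set (ℝ × ℝ) := Ioi 0 ×ˢ Ioi 0 with hA
  have hAm : MeasurableSet A := measurableSet_Ioi.prod measurableSet_Ioi
  -- Extending the weighted integrand by zero lets the shear `y = R - x` and then the scaling `x = R
  -- u` be performed on whole lines.
  set H : ℝ × ℝ → ℝ≥0∞ := A.indicator fun p =>
    ENNReal.ofReal (Real.exp (-p.1)) * ENNReal.ofReal (Real.exp (-p.2)) * F p with hH
  have hHm : Measurable H := (Measurable.mul (by fun_prop) hF).indicator hAm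
  have hH0 : ∀ x y, ¬ (0 < x ∧ 0 < y) → H (x, y) = 0 := fun x y h =>
    indicator_of_notMem (by simpa [hA] using h) _
  have hm : Measurable fun x : ℝ => ENNReal.ofReal (Real.exp (-x)) := by fun_prop
  have h1 : ∫⁻ p, F p ∂(stdExp.prod stdExp) = ∫⁻ p, H p := by
    unfold stdExp
    rw [prod_withDensity hm hm, Measure.prod_restrict,
      lintegral_withDensity_eq_lintegral_mul _ (by fun_prop) hF, ← Measure.volume_eq_prod, hH,
      lintegral_indicator hAm]
    rfl
  have hJ : Measurable fun q : ℝ × ℝ => H (q.1, q.2 - q.1) := hHm.comp (by fun_prop)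
  have hK : Measurable fun q : ℝ × ℝ => ENNReal.ofReal q.1 * H (q.1 * q.2, q.1 - q.1 * q.2) :=
    Measurable.mul (by fun_prop) (hHm.comp (by fun_prop))
  calc ∫⁻ p, F p ∂(stdExp.prod stdExp) = ∫⁻ p, H p := h1
    _ = ∫⁻ x, ∫⁻ y, H (x, y) := by
        rw [Measure.volume_eq_prod, lintegral_prod _ hHm.aemeasurable]
    _ = ∫⁻ x, ∫⁻ R, H (x, R - x) := by
        refine lintegral_congr fun x => ?_
        exact (lintegral_sub_right_eq_self (fun y => H (x, y)) x).symm
    _ = ∫⁻ R, ∫⁻ x, H (x, R - x) := lintegral_lintegral_swap hJ.aemeasurable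
    _ = ∫⁻ R, ∫⁻ u, ENNReal.ofReal R * H (R * u, R - R * u) := by
        refine lintegral_congr fun R => ?_
        rcases lt_or_ge 0 R with hR | hR
        · exact lintegral_comp_mul_left_of_pos hR fun x => H (x, R - x)
        -- For `R ≤ 0` the scaling is unavailable, but both sides vanish: `x` and `R - x` cannot
        -- both be positive, and `ENNReal.ofReal R = 0`.
        · have : ∀ x, H (x, R - x) = 0 := fun x => hH0 _ _ (by rintro ⟨a, b⟩; linarith)
          simp [this, ENNReal.ofReal_of_nonpos hR]
    _ = ∫⁻ u, ∫⁻ R, ENNReal.ofReal R * H (R * u, R - R * u) :=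
        lintegral_lintegral_swap hK.aemeasurable
    _ = _ := by
        rw [← lintegral_indicator measurableSet_Ioo]
        refine lintegral_congr fun u => ?_
        by_cases hu : u ∈ Ioo (0 : ℝ) 1
        · rw [indicator_of_mem hu, ← lintegral_indicator measurableSet_Ioi]
          refine lintegral_congr fun R => ?_
          by_cases hR : R ∈ Ioi (0 : ℝ)
          · have hR0 : 0 < R := hR
            have hmem : (R * u, R - R * u) ∈ A := by
              simp only [hA, mem_prod, mem_Ioi]
              exact ⟨mul_pos hR0 hu.1, by nlinarith [hu.2]⟩
            rw [indicator_of_mem hR, hH, indicator_of_mem hmem, ← ENNReal.ofReal_mul (by positivity),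
              ← Real.exp_add, ← mul_assoc, ← ENNReal.ofReal_mul hR0.le]
            congr 2
            · congr 2
              ring_nf
            · ring_nf
          · rw [indicator_of_notMem hR, ENNReal.ofReal_of_nonpos (not_lt.1 hR), zero_mul]
        · rw [indicator_of_notMem hu, lintegral_eq_zero_iff' (by fun_prop)]
          refine Filter.Eventually.of_forall fun R => ?_
          rcases lt_or_ge 0 R with hR | hR
          · have : H (R * u, R - R * u) = 0 := by
              refine hH0 _ _ ?_
              rintro ⟨ha, hb⟩
              refine hu ⟨(mul_pos_iff_of_pos_left hR).1 ha, ?_⟩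
              by_contra hcon
              nlinarith
            simp [this]
          · simp [ENNReal.ofReal_of_nonpos hR]

/-- `λ ↦ Pr {λ (|h₁|² + |h₂|²) ≥ 1}`. -/
noncomputable def gainTail (l : ℝ) : ℝ := if 0 < l then (1 + l⁻¹) * Real.exp (-l⁻¹) else 0

lemma lintegral_mul_exp_neg_Ici {x : ℝ} (hx : 0 ≤ x) :
    ∫⁻ R in Ioi x, ENNReal.ofReal (R * Real.exp (-R)) =
      ENNReal.ofReal ((1 + x) * Real.exp (-x)) := by
  have hd : ∀ y : ℝ, HasDerivAt (fun R : ℝ => -((1 + R) * Real.exp (-R)))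
      (y * Real.exp (-y)) y := by
    intro y
    have h1 : HasDerivAt (fun x : ℝ => 1 + x) 1 y := (hasDerivAt_id' y).const_add 1
    have h2 : HasDerivAt (fun x : ℝ => Real.exp (-x)) (-Real.exp (-y)) y := by
      simpa using (hasDerivAt_neg y).exp
    exact (h1.fun_mul h2).fun_neg.congr_deriv (by ring)
  have hlim : Filter.Tendsto (fun R : ℝ => -((1 + R) * Real.exp (-R))) Filter.atTop (nhds 0) := by
    have h0 := Real.tendsto_pow_mul_exp_neg_atTop_nhds_zero 0
    have h1 := Real.tendsto_pow_mul_exp_neg_atTop_nhds_zero 1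
    have := (h0.add h1).neg
    simp only [pow_zero, pow_one, add_zero, neg_zero] at this
    refine this.congr fun R => by ring
  have hnn : ∀ y ∈ Ioi x, 0 ≤ y * Real.exp (-y) := fun y hy =>
    mul_nonneg (hx.trans (le_of_lt hy)) (Real.exp_pos _).le
  rw [← ofReal_integral_eq_lintegral_ofReal
    (integrableOn_Ioi_deriv_of_nonneg' (fun y _ => hd y) hnn hlim)
    ((ae_restrict_iff' measurableSet_Ioi).2 (Filter.Eventually.of_forall hnn)),
    integral_Ioi_of_hasDerivAt_of_nonneg' (fun y _ => hd y) hnn hlim]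
  congr 1
  ring

/-- With `R` the sum of the gains and `u` the share of the first, `a|h₁|² + b|h₂|² = R(b + u(a -
b))`, so conditioning on the uniform `u` leaves a tail of `R`. -/
lemma fadingLaw_tail (a b : ℝ) :
    fadingLaw {z | 1 ≤ a * ‖z 0‖ ^ 2 + b * ‖z 1‖ ^ 2} =
      ∫⁻ u in Ioo (0 : ℝ) 1, ENNReal.ofReal (gainTail (b + u * (a - b))) := by
  set A : Set (ℝ × ℝ) := {p | 1 ≤ a * p.1 + b * p.2} with hA
  have hAm : MeasurableSet A := measurableSet_le (by fun_prop) (by fun_prop)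
  have h1 : fadingLaw {z | 1 ≤ a * ‖z 0‖ ^ 2 + b * ‖z 1‖ ^ 2} = (stdExp.prod stdExp) A := by
    rw [← map_powerGains_fadingLaw, Measure.map_apply (by fun_prop) hAm]
    rfl
  rw [h1, ← lintegral_indicator_one hAm, lintegral_stdExp_prod (measurable_one.indicator hAm)]
  refine setLIntegral_congr_fun measurableSet_Ioo fun u _ => ?_
  set l := b + u * (a - b) with hl
  have hmem : ∀ R : ℝ, (R * u, R * (1 - u)) ∈ A ↔ 1 ≤ R * l := by
    intro R
    simp only [hA, mem_ofPred_eq, hl]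
    rw [show a * (R * u) + b * (R * (1 - u)) = R * (b + u * (a - b)) by ring]
  rcases lt_or_ge 0 l with hl0 | hl0
  · rw [gainTail, if_pos hl0, ← lintegral_mul_exp_neg_Ici (inv_pos.2 hl0).le,
      ← setLIntegral_congr (Ioi_ae_eq_Ici (a := l⁻¹)).symm,
      ← lintegral_indicator measurableSet_Ioi, ← lintegral_indicator measurableSet_Ici]
    refine lintegral_congr fun R => ?_
    have hiff : (R * u, R * (1 - u)) ∈ A ↔ R ∈ Ici l⁻¹ := by
      rw [hmem, mem_Ici, inv_le_iff_one_le_mul₀ hl0]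
    by_cases hR : R ∈ Ici l⁻¹
    · have hR0 : R ∈ Ioi (0 : ℝ) := lt_of_lt_of_le (inv_pos.2 hl0) hR
      rw [indicator_of_mem hR, indicator_of_mem hR0, indicator_of_mem (hiff.2 hR)]
      simp
    · rw [indicator_of_notMem hR, indicator_apply, indicator_of_notMem (fun h => hR (hiff.1 h))]
      simp
  · rw [gainTail, if_neg hl0.not_gt, ENNReal.ofReal_zero]
    rw [setLIntegral_congr_fun (g := fun _ => 0) measurableSet_Ioi, lintegral_zero]
    intro R hR
    have hR0 : 0 < R := hR
    have : (R * u, R * (1 - u)) ∉ A := by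
      rw [hmem]
      nlinarith
    simp [indicator_of_notMem this]

lemma fadingLaw_gain_tail {s : ℝ} (hs : 0 < s) :
    fadingLaw {z | s ≤ ‖z 0‖ ^ 2 + ‖z 1‖ ^ 2} = ENNReal.ofReal ((1 + s) * Real.exp (-s)) := by
  have h : {z : Fin 2 → ℂ | s ≤ ‖z 0‖ ^ 2 + ‖z 1‖ ^ 2} =
      {z | 1 ≤ s⁻¹ * ‖z 0‖ ^ 2 + s⁻¹ * ‖z 1‖ ^ 2} := by
    ext z
    simp only [mem_ofPred_eq]
    rw [← mul_add, inv_mul_eq_div, one_le_div hs]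
  rw [h, fadingLaw_tail]
  simp [gainTail, hs]

/-! ### The marginal rate of a layer -/

/-- The total interference power at which the layer for the gain `s` is the optimal one. -/
noncomputable def thresholdPower (s : ℝ) : ℝ := 2 * (1 + s - s ^ 2) / s ^ 3

/-- The optimal rate per unit of power, at the interference `thresholdPower s`. -/
noncomputable def marginalRate (s : ℝ) : ℝ := s ^ 3 * Real.exp (-s) / 2

lemma marginalRate_pos {s : ℝ} (hs : 0 < s) : 0 < marginalRate s := by
  unfold marginalRate
  positivity

lemma thresholdPower_nonneg {s : ℝ} (hs : 0 < s) (hs' : s ^ 2 ≤ 1 + s) :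
    0 ≤ thresholdPower s := by
  unfold thresholdPower
  have : 0 ≤ 1 + s - s ^ 2 := by linarith
  positivity

/-- This is the tangent bound in the normalization used for pricing: slope `2 * marginalRate s`,
intercept `marginalRate s * thresholdPower s`. Averaged over `u`, the term `2l` becomes the trace `a
+ b`. -/
lemma gainTail_le {l s : ℝ} (hl : 0 < l) (hs : 0 < s) (hs' : s ^ 2 ≤ 1 + s) :
    gainTail l ≤ marginalRate s * (2 * l + thresholdPower s) := by
  rw [gainTail, if_pos hl]
  refine (tail_le_tangent (inv_pos.2 hl) hs hs').trans_eq ?_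
  unfold marginalRate thresholdPower
  field_simp
  ring

lemma setLIntegral_affine {c m k : ℝ} (hc : c ≤ 1) (h0 : ∀ u ∈ Ioo c 1, 0 ≤ m + k * u) :
    ∫⁻ u in Ioo c 1, ENNReal.ofReal (m + k * u) =
      ENNReal.ofReal (m * (1 - c) + k * ((1 - c ^ 2) / 2)) := by
  have hi : IntegrableOn (fun u : ℝ => m + k * u) (Ioo c 1) :=
    ((by fun_prop : Continuous fun u : ℝ => m + k * u).integrableOn_Icc).mono_set Ioo_subset_Icc_self
  rw [← ofReal_integral_eq_lintegral_ofReal hi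
    ((ae_restrict_iff' measurableSet_Ioo).2 (Filter.Eventually.of_forall h0)),
    ← integral_Ioc_eq_integral_Ioo, ← intervalIntegral.integral_of_le hc,
    intervalIntegral.integral_add (by simp)
      ((by fun_prop : Continuous fun u : ℝ => k * u).intervalIntegrable _ _)]
  rw [intervalIntegral.integral_const, intervalIntegral.integral_const_mul, integral_id, smul_eq_mul]
  ring_nf

lemma fadingLaw_map_eq {V : Matrix (Fin 2) (Fin 2) ℂ} (hV : V * Vᴴ = 1) {A : Set (Fin 2 → ℂ)}
    (hA : MeasurableSet A) : fadingLaw {z | z ᵥ* V ∈ A} = fadingLaw A := by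
  have hm : Measurable fun z : Fin 2 → ℂ => z ᵥ* V :=
    (Continuous.matrix_vecMul continuous_id continuous_const).measurable
  conv_rhs => rw [← map_vecMul_fadingLaw hV, Measure.map_apply hm hA]
  rfl

lemma swap_mul_conjTranspose :
    (!![0, 1; 1, 0] : Matrix (Fin 2) (Fin 2) ℂ) * (!![0, 1; 1, 0] : Matrix _ _ ℂ)ᴴ = 1 := by
  ext i j
  fin_cases i <;> fin_cases j <;> simp [Matrix.mul_apply]

lemma vecMul_swap (z : Fin 2 → ℂ) : z ᵥ* !![0, 1; 1, 0] = ![z 1, z 0] := by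
  ext i
  fin_cases i <;> simp [vecMul, dotProduct]

lemma measurableSet_tail (a b : ℝ) :
    MeasurableSet {z : Fin 2 → ℂ | 1 ≤ a * ‖z 0‖ ^ 2 + b * ‖z 1‖ ^ 2} :=
  measurableSet_le (by fun_prop) (by fun_prop)

lemma fadingLaw_tail_comm (a b : ℝ) :
    fadingLaw {z | 1 ≤ a * ‖z 0‖ ^ 2 + b * ‖z 1‖ ^ 2} =
      fadingLaw {z | 1 ≤ b * ‖z 0‖ ^ 2 + a * ‖z 1‖ ^ 2} := by
  rw [← fadingLaw_map_eq swap_mul_conjTranspose (measurableSet_tail a b)]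
  congr 1
  ext z
  simp only [mem_ofPred_eq, vecMul_swap]
  simp [add_comm]

/-- The tangent is integrated only over those `u` with `b + u(a - b) > 0`, since `gainTail` vanishes
elsewhere. For `b < 0` this truncation costs something compared with the full integral, and the
lower bound on `b` pays for it. -/
lemma fadingLaw_tail_le_of_le {a b s : ℝ} (hs : 0 < s) (hs' : s ^ 2 ≤ 1 + s) (hba : b ≤ a)
    (hb : -thresholdPower s ≤ b) :
    fadingLaw {z | 1 ≤ a * ‖z 0‖ ^ 2 + b * ‖z 1‖ ^ 2} ≤
      ENNReal.ofReal (marginalRate s * (a + b + thresholdPower s)) := by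
  rw [fadingLaw_tail]
  set w := marginalRate s
  set τ := thresholdPower s with hτdef
  have hw : 0 < w := marginalRate_pos hs
  have hτ : 0 ≤ τ := thresholdPower_nonneg hs hs'
  have hline : ∀ u, w * (2 * (b + u * (a - b)) + τ) =
      w * (2 * b + τ) + w * (2 * (a - b)) * u := fun u => by ring
  have hpt : ∀ u, ENNReal.ofReal (gainTail (b + u * (a - b))) ≤
      {u | 0 < b + u * (a - b)}.indicator (fun u => ENNReal.ofReal
        (w * (2 * b + τ) + w * (2 * (a - b)) * u)) u := by
    intro u
    by_cases hu : 0 < b + u * (a - b)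
    · rw [indicator_of_mem (show u ∈ {u | 0 < b + u * (a - b)} from hu), ← hline]
      exact ENNReal.ofReal_le_ofReal (gainTail_le hu hs hs')
    · simp [gainTail, hu]
  rcases le_or_gt 0 b with hb0 | hb0
  · calc _ ≤ ∫⁻ u in Ioo (0 : ℝ) 1, ENNReal.ofReal
          (w * (2 * b + τ) + w * (2 * (a - b)) * u) :=
          lintegral_mono fun u => (hpt u).trans (indicator_le_self _ _ _)
      _ = ENNReal.ofReal (w * (a + b + τ)) := by
          rw [setLIntegral_affine zero_le_one]
          · congr 1
            ring
          · intro u hu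
            rw [← hline]
            have := mul_nonneg hu.1.le (sub_nonneg.2 hba)
            positivity
      _ ≤ _ := le_rfl
  rcases le_or_gt a 0 with ha0 | ha0
  · have h0 : ∀ u ∈ Ioo (0 : ℝ) 1, ENNReal.ofReal (gainTail (b + u * (a - b))) = 0 := by
      intro u hu
      have : ¬ 0 < b + u * (a - b) := by nlinarith [hu.1, hu.2]
      simp [gainTail, this]
    rw [setLIntegral_congr_fun measurableSet_Ioo h0]
    simp
  · have hab : 0 < a - b := by linarith
    -- The share at which `b + u(a - b)` changes sign.
    set c := -b / (a - b) with hc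
    have hc0 : 0 ≤ c := div_nonneg (by linarith) hab.le
    have hc1 : c ≤ 1 := by rw [hc, div_le_one hab]; linarith
    have hmem : ∀ u, 0 < b + u * (a - b) ↔ c < u := by
      intro u
      rw [hc, div_lt_iff₀ hab]
      constructor <;> intro h <;> linarith
    calc _ ≤ ∫⁻ u in Ioo (0 : ℝ) 1, (Ioi c).indicator (fun u => ENNReal.ofReal
            (w * (2 * b + τ) + w * (2 * (a - b)) * u)) u := by
          refine lintegral_mono fun u => (hpt u).trans_eq ?_
          congr 1
          ext u
          exact hmem u
      _ = ∫⁻ u in Ioo c 1, ENNReal.ofReal (w * (2 * b + τ) + w * (2 * (a - b)) * u) := by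
          rw [setLIntegral_indicator measurableSet_Ioi]
          congr 2
          ext u
          simp only [mem_inter_iff, mem_Ioi, mem_Ioo]
          exact ⟨fun h => ⟨h.1, h.2.2⟩, fun h => ⟨h.1, hc0.trans_lt h.1, h.2⟩⟩
      _ = ENNReal.ofReal (w * (a * (a + τ) / (a - b))) := by
          rw [setLIntegral_affine hc1]
          · congr 1
            rw [hc]
            field_simp
            ring
          · intro u hu
            rw [← hline]
            have := (hmem u).2 hu.1
            positivity
      _ ≤ _ := by
          apply ENNReal.ofReal_le_ofReal
          apply mul_le_mul_of_nonneg_left _ hw.le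
          rw [div_le_iff₀ hab]
          -- After clearing `a - b` the inequality reads `b(b + τ) ≤ 0`, which holds as `-τ ≤ b <
          -- 0`.
          nlinarith

lemma fadingLaw_tail_le {a b s : ℝ} (hs : 0 < s) (hs' : s ^ 2 ≤ 1 + s)
    (ha : -thresholdPower s ≤ a) (hb : -thresholdPower s ≤ b) :
    fadingLaw {z | 1 ≤ a * ‖z 0‖ ^ 2 + b * ‖z 1‖ ^ 2} ≤
      ENNReal.ofReal (marginalRate s * (a + b + thresholdPower s)) := by
  rcases le_total b a with h | h
  · exact fadingLaw_tail_le_of_le hs hs' h hb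
  · rw [fadingLaw_tail_comm, add_comm a b]
    exact fadingLaw_tail_le_of_le hs hs' h ha

lemma receivedPower_sub_smul (z : Fin 2 → ℂ) (Q S : Matrix (Fin 2) (Fin 2) ℂ) (r : ℝ) :
    receivedPower z (Q - (r : ℂ) • S) = receivedPower z Q - r * receivedPower z S := by
  unfold receivedPower
  rw [sub_mulVec, dotProduct_sub, smul_mulVec, dotProduct_smul, Complex.sub_re, smul_eq_mul,
    Complex.re_ofReal_mul]

lemma receivedPower_nonneg {Q : Matrix (Fin 2) (Fin 2) ℂ} (hQ : Q.PosSemidef) (z : Fin 2 → ℂ) :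
    0 ≤ receivedPower z Q := by
  have := hQ.dotProduct_mulVec_nonneg (star z)
  rw [star_star] at this
  exact (Complex.le_def.1 this).1

lemma receivedPower_conj_diagonal (z : Fin 2 → ℂ) (V : Matrix (Fin 2) (Fin 2) ℂ) (d : Fin 2 → ℝ) :
    receivedPower z (V * diagonal (fun i => (d i : ℂ)) * Vᴴ) =
      d 0 * ‖(z ᵥ* V) 0‖ ^ 2 + d 1 * ‖(z ᵥ* V) 1‖ ^ 2 := by
  unfold receivedPower
  rw [Matrix.mul_assoc, ← mulVec_mulVec, dotProduct_mulVec, ← mulVec_mulVec, ← star_vecMul]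
  have h : ∀ y : Fin 2 → ℂ, y ⬝ᵥ (diagonal (fun i => (d i : ℂ)) *ᵥ star y) =
      ((d 0 * ‖y 0‖ ^ 2 + d 1 * ‖y 1‖ ^ 2 : ℝ) : ℂ) := by
    intro y
    simp only [dotProduct, Fin.sum_univ_two, mulVec_diagonal, Pi.star_apply, RCLike.star_def]
    push_cast
    rw [← Complex.mul_conj', ← Complex.mul_conj']
    ring
  rw [h, Complex.ofReal_re]

lemma trace_re_nonneg {Q : Matrix (Fin 2) (Fin 2) ℂ} (hQ : Q.PosSemidef) : 0 ≤ Q.trace.re :=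
  (Complex.le_def.1 hQ.trace_nonneg).1

lemma diag_re_le_trace_re {S : Matrix (Fin 2) (Fin 2) ℂ} (hS : S.PosSemidef) (i : Fin 2) :
    0 ≤ (S i i).re ∧ (S i i).re ≤ S.trace.re := by
  have h : ∀ i, 0 ≤ (S i i).re := fun i => (Complex.le_def.1 (hS.diag_nonneg (i := i))).1
  refine ⟨h i, ?_⟩
  rw [trace_fin_two, Complex.add_re]
  have h0 := h 0
  have h1 := h 1
  fin_cases i <;> simp <;> linarith

/-- No layer gains more rate per unit of power than the isotropic layer for the gain `s`, if the
total power of the interference is `thresholdPower s`. -/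
lemma fadingLaw_decodable_mul_le {Q S : Matrix (Fin 2) (Fin 2) ℂ} (hQ : Q.PosSemidef)
    (hS : S.PosSemidef) {s : ℝ} (hs : 0 < s) (hs' : s ^ 2 ≤ 1 + s)
    (hτ : S.trace.re = thresholdPower s) (r : ℝ≥0) :
    fadingLaw {z | (r : ℝ) ≤ receivedPower z Q / (1 + receivedPower z S)} * (r : ℝ≥0∞) ≤
      ENNReal.ofReal (marginalRate s * Q.trace.re) := by
  rcases eq_or_ne r 0 with hr0 | hr0
  · simp [hr0]
  have hr : (0 : ℝ) < r := NNReal.coe_pos.2 (pos_iff_ne_zero.2 hr0)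
  -- Decodability is linear after clearing the denominator: `z M z† ≥ r`.
  set M : Matrix (Fin 2) (Fin 2) ℂ := Q - ((r : ℝ) : ℂ) • S with hMdef
  have hM : M.IsHermitian := by
    refine hQ.1.sub ?_
    rw [IsHermitian, conjTranspose_smul, hS.1.eq]
    simp
  set V : Matrix (Fin 2) (Fin 2) ℂ := hM.eigenvectorUnitary.1 with hV
  have hVV : V * Vᴴ = 1 := Unitary.coe_mul_star_self hM.eigenvectorUnitary
  have hVV' : Vᴴ * V = 1 := Unitary.coe_star_mul_self hM.eigenvectorUnitary
  set d := hM.eigenvalues with hd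
  have hspec : M = V * diagonal (fun i => (d i : ℂ)) * Vᴴ := by
    conv_lhs => rw [hM.spectral_theorem, Unitary.conjStarAlgAut_apply]
    rfl
  have hQS : Vᴴ * Q * V = diagonal (fun i => (d i : ℂ)) + ((r : ℝ) : ℂ) • (Vᴴ * S * V) := by
    have h1 : Vᴴ * M * V = diagonal (fun i => (d i : ℂ)) := by
      rw [hspec]
      simp only [Matrix.mul_assoc]
      rw [hVV', Matrix.mul_one, ← Matrix.mul_assoc, hVV', Matrix.one_mul]
    rw [← h1, hMdef]
    simp [Matrix.mul_sub, Matrix.sub_mul]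
  have hQ' : (Vᴴ * Q * V).PosSemidef := hQ.conjTranspose_mul_mul_same V
  have hS' : (Vᴴ * S * V).PosSemidef := hS.conjTranspose_mul_mul_same V
  have htS : (Vᴴ * S * V).trace = S.trace := by
    rw [trace_mul_cycle, hVV, Matrix.one_mul]
  have htQ : (Vᴴ * Q * V).trace = Q.trace := by
    rw [trace_mul_cycle, hVV, Matrix.one_mul]
  -- In the eigenbasis `Q` has nonnegative diagonal and each diagonal entry of `S` is at most its
  -- trace, so no eigenvalue of `M` is below `-r tr S`.
  have hlow : ∀ i, -thresholdPower s ≤ d i / r := by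
    intro i
    have h1 := (diag_re_le_trace_re hQ' i).1
    have h2 := (diag_re_le_trace_re hS' i).2
    rw [htS, hτ] at h2
    rw [hQS] at h1
    simp only [Matrix.add_apply, diagonal_apply_eq, Matrix.smul_apply, smul_eq_mul, Complex.add_re,
      Complex.ofReal_re, Complex.re_ofReal_mul] at h1
    rw [le_div_iff₀ hr]
    nlinarith
  -- The rate `r` cancels here: `r` times `a + b + T(s)` is exactly the trace of `Q`.
  have hsum : Q.trace.re = d 0 + d 1 + r * thresholdPower s := by
    rw [← htQ, hQS, trace_add, trace_smul, htS, ← hτ]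
    simp [trace_fin_two]
  have hev : {z | (r : ℝ) ≤ receivedPower z Q / (1 + receivedPower z S)} =
      {z | z ᵥ* V ∈ {y : Fin 2 → ℂ | 1 ≤ d 0 / r * ‖y 0‖ ^ 2 + d 1 / r * ‖y 1‖ ^ 2}} := by
    ext z
    have h1 : 0 < 1 + receivedPower z S := by linarith [receivedPower_nonneg hS z]
    have h2 := receivedPower_sub_smul z Q S r
    rw [← hMdef, hspec, receivedPower_conj_diagonal] at h2
    simp only [mem_ofPred_eq]
    rw [le_div_iff₀ h1, div_mul_eq_mul_div, div_mul_eq_mul_div, ← add_div, h2, one_le_div hr]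
    constructor <;> intro h <;> linarith
  rw [hev, fadingLaw_map_eq hVV (measurableSet_tail _ _)]
  calc _ ≤ ENNReal.ofReal (marginalRate s * (d 0 / r + d 1 / r + thresholdPower s)) *
        ENNReal.ofReal r := by
        rw [ENNReal.ofReal_coe_nnreal]
        gcongr
        exact fadingLaw_tail_le hs hs' (hlow 0) (hlow 1)
    _ = ENNReal.ofReal (marginalRate s * Q.trace.re) := by
        rw [← ENNReal.ofReal_mul' hr.le, hsum]
        congr 1
        field_simp

/-! ### Substituting the interference for the layer index -/

section Interference

variable {q : ℝ → ℝ}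

lemma interference_antitone (hq0 : ∀ s, 0 ≤ q s) (hq : Integrable q) :
    Antitone (interference q) := fun _ _ hab =>
  setIntegral_mono_set hq.integrableOn (ae_of_all _ hq0) (Ioi_subset_Ioi hab).eventuallyLE

lemma interference_nonneg (hq0 : ∀ s, 0 ≤ q s) (s : ℝ) : 0 ≤ interference q s :=
  integral_nonneg hq0

lemma interference_add_integral_Iic (hq : Integrable q) (s : ℝ) :
    (∫ t in Iic s, q t) + interference q s = ∫ t, q t := by
  have := integral_add_compl (μ := volume) (measurableSet_Iic (a := s)) hq
  rwa [compl_Iic] at this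

lemma interference_continuous (hq : Integrable q) : Continuous (interference q) := by
  have h : interference q = fun s => interference q 0 - ∫ t in (0 : ℝ)..s, q t := by
    funext s
    rw [← intervalIntegral.integral_Ioi_sub_Ioi' hq.integrableOn hq.integrableOn]
    exact (sub_sub_cancel _ _).symm
  rw [h]
  exact continuous_const.sub (intervalIntegral.continuous_primitive (fun _ _ => hq.intervalIntegrable) 0)

lemma withDensity_Ioi (hq0 : ∀ s, 0 ≤ q s) (hq : Integrable q) (s : ℝ) :
    volume.withDensity (fun t => ENNReal.ofReal (q t)) (Ioi s) =
      ENNReal.ofReal (interference q s) := by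
  rw [withDensity_apply _ measurableSet_Ioi, interference,
    ofReal_integral_eq_lintegral_ofReal hq.integrableOn (ae_of_all _ hq0)]

lemma exists_interference_eq (hq : Integrable q) {x : ℝ}
    (hx : 0 < x) (hx' : x < ∫ t, q t) : ∃ s, interference q s = x := by
  have htop : Filter.Tendsto (interference q) Filter.atTop (nhds 0) :=
    tendsto_integral_Ioi_zero Filter.tendsto_id
  have hbot : Filter.Tendsto (interference q) Filter.atBot (nhds (∫ t, q t)) := by
    have h := (tendsto_integral_Iic_zero (f := q) (μ := volume) Filter.tendsto_id).const_sub
      (∫ t, q t)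
    rw [sub_zero] at h
    exact h.congr fun s => by rw [← interference_add_integral_Iic hq s, id, add_sub_cancel_left]
  obtain ⟨a, ha⟩ := (htop.eventually (gt_mem_nhds hx)).exists
  obtain ⟨b, hb⟩ := (hbot.eventually (lt_mem_nhds hx')).exists
  exact mem_range_of_exists_le_of_exists_ge (interference_continuous hq) ⟨a, ha.le⟩ ⟨b, hb.le⟩

/-- The interference maps the power density to Lebesgue measure. -/
lemma map_interference (hq0 : ∀ s, 0 ≤ q s) (hq : Integrable q) :
    (volume.withDensity (fun t => ENNReal.ofReal (q t))).map (interference q) =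
      volume.restrict (Icc 0 (∫ t, q t)) := by
  set ν := volume.withDensity (fun t => ENNReal.ofReal (q t)) with hν
  set I := ∫ t, q t with hI
  have huniv : ν univ = ENNReal.ofReal I := by
    rw [hν, withDensity_apply _ MeasurableSet.univ, Measure.restrict_univ,
      ofReal_integral_eq_lintegral_ofReal hq (ae_of_all _ hq0)]
  have : IsFiniteMeasure ν := ⟨by rw [huniv]; exact ENNReal.ofReal_lt_top⟩
  have hm := (interference_antitone hq0 hq).measurable
  have hI0 : 0 ≤ I := integral_nonneg hq0
  apply Measure.ext_of_Iic
  intro x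
  rw [Measure.map_apply hm measurableSet_Iic, Measure.restrict_apply measurableSet_Iic]
  rcases lt_or_ge x 0 with hx | hx
  · have h1 : interference q ⁻¹' Iic x = ∅ := by
      ext s
      simp only [mem_preimage, mem_Iic, mem_empty_iff_false, iff_false, not_le]
      exact hx.trans_le (interference_nonneg hq0 s)
    have h2 : Iic x ∩ Icc 0 I = ∅ := by
      ext s
      simp only [mem_inter_iff, mem_Iic, mem_Icc, mem_empty_iff_false, iff_false]
      rintro ⟨ha, hb, -⟩
      linarith
    rw [h1, h2, measure_empty, measure_empty]
  have h2 : Iic x ∩ Icc 0 I = Icc 0 (min x I) := by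
    ext s
    simp only [mem_inter_iff, mem_Iic, mem_Icc, le_min_iff]
    tauto
  rw [h2, Real.volume_Icc, sub_zero]
  apply le_antisymm
  -- The interference may be constant on intervals, so a sublevel set need not be the open ray at a
  -- given point of level `x`. It is contained in the ray starting at any point of a higher level
  -- `y`, and `y` then decreases to `x`.
  · have hle : ∀ y, x < y → ν (interference q ⁻¹' Iic x) ≤ ENNReal.ofReal y := by
      intro y hy
      rcases lt_or_ge y I with hyI | hyI
      · obtain ⟨s, hs⟩ := exists_interference_eq hq (hx.trans_lt hy) hyI
        rw [← hs, ← withDensity_Ioi hq0 hq]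
        refine measure_mono fun t ht => ?_
        by_contra hts
        have h3 := interference_antitone hq0 hq (not_lt.1 hts)
        have h4 : interference q t ≤ x := ht
        linarith
      · exact (measure_mono (subset_univ _)).trans
          (huniv.le.trans (ENNReal.ofReal_le_ofReal hyI))
    rw [ENNReal.ofReal_min]
    refine le_min ?_ ((measure_mono (subset_univ _)).trans huniv.le)
    refine ENNReal.le_of_forall_pos_le_add fun ε hε _ => ?_
    rw [← ENNReal.ofReal_coe_nnreal, ← ENNReal.ofReal_add hx ε.coe_nonneg]
    exact hle _ (lt_add_of_pos_right _ hε)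
  · rcases lt_or_ge x I with hxI | hxI
    · rw [min_eq_left hxI.le]
      rcases hx.eq_or_lt with h0 | h0
      · simp [← h0]
      · obtain ⟨s, hs⟩ := exists_interference_eq hq h0 hxI
        conv_lhs => rw [← hs, ← withDensity_Ioi hq0 hq]
        refine measure_mono fun t ht => ?_
        simp only [mem_preimage, mem_Iic]
        rw [← hs]
        exact interference_antitone hq0 hq (le_of_lt ht)
    · rw [min_eq_right hxI, ← huniv]
      refine measure_mono fun t _ => ?_
      simp only [mem_preimage, mem_Iic]
      have h3 := interference_add_integral_Iic hq t
      have h4 : 0 ≤ ∫ u in Iic t, q u := integral_nonneg hq0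
      linarith

/-- The substitution `x = I(t)`, valid for a merely integrable density because it is proved through
the image measure and not through `I'`. -/
lemma lintegral_comp_interference (hq0 : ∀ s, 0 ≤ q s) (hq : Integrable q) {f : ℝ → ℝ≥0∞}
    (hf : Measurable f) :
    ∫⁻ s, ENNReal.ofReal (q s) * f (interference q s) = ∫⁻ x in Icc 0 (∫ t, q t), f x := by
  have hm := (interference_antitone hq0 hq).measurable
  rw [← map_interference hq0 hq, lintegral_map hf hm,
    lintegral_withDensity_eq_lintegral_mul₀ hq.aemeasurable.ennreal_ofReal
      (g := fun s => f (interference q s)) (hf.comp hm).aemeasurable]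
  rfl

end Interference

/-! ### The optimal rate -/

lemma integrableOn_exp_neg_div {a : ℝ} (ha : 0 < a) :
    IntegrableOn (fun t => Real.exp (-t) / t) (Ioi a) := by
  have h1 : IntegrableOn (fun t => a⁻¹ * Real.exp (-t)) (Ioi a) :=
    (integrableOn_exp_neg_Ioi a).const_mul _
  have hm : Measurable fun t : ℝ => Real.exp (-t) / t :=
    Measurable.div (by fun_prop) measurable_id
  refine Integrable.mono' h1 hm.aestronglyMeasurable ?_
  refine (ae_restrict_iff' measurableSet_Ioi).2 (ae_of_all _ fun t ht => ?_)
  have ht0 : 0 < t := ha.trans ht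
  rw [Real.norm_of_nonneg (by positivity), div_eq_inv_mul]
  gcongr
  exact le_of_lt ht

lemma E₁_sub_E₁ {a b : ℝ} (ha : 0 < a) (hab : a ≤ b) :
    E₁ a - E₁ b = ∫ t in a..b, Real.exp (-t) / t :=
  intervalIntegral.integral_Ioi_sub_Ioi (integrableOn_exp_neg_div ha) hab

lemma integral_layer_rate {a b : ℝ} (ha : 0 < a) (hab : a ≤ b) :
    ∫ s in a..b, Real.exp (-s) * (3 / s + 2 - s) = rateFormula a b := by
  have hd : ∀ s : ℝ, HasDerivAt (fun s : ℝ => (s - 1) * Real.exp (-s))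
      ((2 - s) * Real.exp (-s)) s := by
    intro s
    have h1 : HasDerivAt (fun s : ℝ => s - 1) 1 s := (hasDerivAt_id' s).sub_const 1
    have h2 : HasDerivAt (fun x : ℝ => Real.exp (-x)) (-Real.exp (-s)) s := by
      simpa using (hasDerivAt_neg s).exp
    exact (h1.fun_mul h2).congr_deriv (by ring)
  have hc2 : Continuous fun s : ℝ => (2 - s) * Real.exp (-s) := by fun_prop
  have hi1 : IntervalIntegrable (fun t => Real.exp (-t) / t) volume a b :=
    (intervalIntegrable_iff_integrableOn_Ioc_of_le hab).2
      ((integrableOn_exp_neg_div ha).mono_set Ioc_subset_Ioi_self)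
  have h2 := intervalIntegral.integral_eq_sub_of_hasDerivAt (fun s _ => hd s)
    (hc2.intervalIntegrable a b)
  have h3 : ∀ s : ℝ, Real.exp (-s) * (3 / s + 2 - s) =
      3 * (Real.exp (-s) / s) + (2 - s) * Real.exp (-s) := fun s => by ring
  simp_rw [h3]
  rw [intervalIntegral.integral_add (hi1.const_mul 3) (hc2.intervalIntegrable a b), h2,
    intervalIntegral.integral_const_mul, ← E₁_sub_E₁ ha hab, rateFormula]
  ring

lemma layer_rate_nonneg {s : ℝ} (hs : 0 < s) (hs3 : s ≤ 3) : 0 ≤ 3 / s + 2 - s := by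
  rw [show 3 / s + 2 - s = (3 - s) * (1 + s) / s by field_simp; ring]
  have : 0 ≤ 3 - s := by linarith
  positivity

lemma lintegral_layer_rate {a b : ℝ} (ha : 0 < a) (hab : a ≤ b) (hb : b ≤ 3) :
    ∫⁻ s in Icc a b, ENNReal.ofReal (Real.exp (-s) * (3 / s + 2 - s)) =
      ENNReal.ofReal (rateFormula a b) := by
  have hc : ContinuousOn (fun s : ℝ => Real.exp (-s) * (3 / s + 2 - s)) (Icc a b) := by
    have : ∀ s ∈ Icc a b, s ≠ 0 := fun s hs => (ha.trans_le hs.1).ne'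
    fun_prop (disch := assumption)
  rw [← integral_layer_rate ha hab, intervalIntegral.integral_of_le hab,
    ← integral_Icc_eq_integral_Ioc, ofReal_integral_eq_lintegral_ofReal hc.integrableOn_Icc]
  refine (ae_restrict_iff' measurableSet_Icc).2 (ae_of_all _ fun s hs => ?_)
  exact mul_nonneg (Real.exp_pos _).le
    (layer_rate_nonneg (ha.trans_le hs.1) (hs.2.trans hb))

lemma hasDerivAt_thresholdPower {s : ℝ} (hs : 0 < s) :
    HasDerivAt thresholdPower (-(2 * (3 + 2 * s - s ^ 2) / s ^ 4)) s := by
  have h1 : HasDerivAt (fun x : ℝ => 2 * (1 + x - x ^ 2)) (2 * (1 - 2 * s)) s := by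
    have : HasDerivAt (fun x : ℝ => 1 + x - x ^ 2) (1 - 2 * s) s := by
      simpa using ((hasDerivAt_id s).const_add 1).fun_sub (hasDerivAt_pow 2 s)
    exact this.const_mul 2
  have h2 : HasDerivAt (fun x : ℝ => x ^ 3) (3 * s ^ 2) s := by simpa using hasDerivAt_pow 3 s
  refine (h1.fun_div h2 (by positivity)).congr_deriv ?_
  field_simp
  ring

lemma continuousOn_thresholdPower {a b : ℝ} (ha : 0 < a) :
    ContinuousOn thresholdPower (Icc a b) := fun _ hx =>
  (hasDerivAt_thresholdPower (ha.trans_le hx.1)).continuousAt.continuousWithinAt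

lemma strictAntiOn_thresholdPower {a b : ℝ} (ha : 0 < a) (hb : b ≤ 3) :
    StrictAntiOn thresholdPower (Icc a b) := by
  apply strictAntiOn_of_deriv_neg (convex_Icc a b) (continuousOn_thresholdPower ha)
  intro x hx
  rw [interior_Icc] at hx
  have hx0 : 0 < x := ha.trans hx.1
  have hx3 : x < 3 := hx.2.trans_le hb
  rw [(hasDerivAt_thresholdPower hx0).deriv, neg_lt_zero]
  have : 0 < 3 + 2 * x - x ^ 2 := by nlinarith
  positivity

/-- The Jacobian of `x = thresholdPower s` times the price at `s` is the integrand of the optimal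
rate; `s ≤ 3` fixes the sign of the Jacobian. -/
lemma thresholdPower_mul_marginalRate {s : ℝ} (hs : 0 < s) (hs3 : s ≤ 3) :
    |-(2 * (3 + 2 * s - s ^ 2) / s ^ 4)| * marginalRate s =
      Real.exp (-s) * (3 / s + 2 - s) := by
  have : 0 ≤ 3 + 2 * s - s ^ 2 := by nlinarith
  rw [abs_neg, abs_of_nonneg (by positivity), marginalRate]
  field_simp

/-- If no layer has more rate per unit of power than the optimal one at its interference, the total
rate is at most the optimal one. -/
lemma lintegral_le_rateFormula {s₀ s₁ P : ℝ} (h0 : 0 < s₀) (h01 : s₀ < s₁) (h1 : s₁ ^ 2 = 1 + s₁)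
    (hT : thresholdPower s₀ = P) {q : ℝ → ℝ} (hq0 : ∀ t ∈ Ioi (0 : ℝ), 0 ≤ q t)
    (hq : IntegrableOn q (Ioi 0)) (hqP : ∫ t in Ioi (0 : ℝ), q t ≤ P) {φ : ℝ → ℝ≥0∞}
    (hφ : ∀ t ∈ Ioi (0 : ℝ), ∀ s ∈ Icc s₀ s₁, thresholdPower s = interference q t →
      φ t ≤ ENNReal.ofReal (marginalRate s * q t)) :
    ∫⁻ t in Ioi (0 : ℝ), φ t ≤ ENNReal.ofReal (rateFormula s₀ s₁) := by
  have hs13 : s₁ ≤ 3 := by nlinarith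
  have hT1 : thresholdPower s₁ = 0 := by
    rw [thresholdPower, h1]
    simp
  have hanti := strictAntiOn_thresholdPower (b := s₁) h0 hs13
  have hP0 : 0 ≤ P := by
    rw [← hT, ← hT1]
    exact (hanti ⟨le_rfl, h01.le⟩ ⟨h01.le, le_rfl⟩ h01).le
  have hivt : ∀ x, ∃ s ∈ Icc s₀ s₁, thresholdPower s = max 0 (min x P) := by
    intro x
    have h := intermediate_value_Icc' h01.le (continuousOn_thresholdPower (b := s₁) h0)
    rw [hT1, hT] at h
    exact h ⟨le_max_left _ _, max_le hP0 (min_le_right _ _)⟩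
  -- `σ` inverts `thresholdPower` on `[0, P]`. Clamping its argument makes it antitone on all of
  -- `ℝ`, hence measurable.
  choose σ hσmem hσ using hivt
  have hσanti : Antitone σ := by
    intro x y hxy
    by_contra hcon
    have h2 := hanti (hσmem x) (hσmem y) (not_le.1 hcon)
    rw [hσ, hσ] at h2
    exact absurd (max_le_max_left 0 (min_le_min_right P hxy)) (not_le.2 h2)
  have hclamp : ∀ x ∈ Icc 0 P, max 0 (min x P) = x := fun x hx => by
    rw [min_eq_left hx.2, max_eq_right hx.1]
  have hTmem : ∀ s ∈ Icc s₀ s₁, thresholdPower s ∈ Icc 0 P := by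
    intro s hs
    rw [← hT1, ← hT]
    exact ⟨hanti.antitoneOn hs ⟨h01.le, le_rfl⟩ hs.2, hanti.antitoneOn ⟨le_rfl, h01.le⟩ hs hs.1⟩
  have himg : thresholdPower '' Icc s₀ s₁ = Icc 0 P := by
    apply Subset.antisymm
    · rintro _ ⟨s, hs, rfl⟩
      exact hTmem s hs
    · exact fun x hx => ⟨σ x, hσmem x, (hσ x).trans (hclamp x hx)⟩
  have hσT : ∀ s ∈ Icc s₀ s₁, σ (thresholdPower s) = s := fun s hs =>
    hanti.injOn (hσmem _) hs ((hσ _).trans (hclamp _ (hTmem s hs)))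
  set f : ℝ → ℝ≥0∞ := fun x => ENNReal.ofReal (marginalRate (σ x)) with hf
  have hfm : Measurable f := by
    have hmr : Measurable marginalRate := by unfold marginalRate; fun_prop
    exact (hmr.comp hσanti.measurable).ennreal_ofReal
  -- Nothing is assumed about `q` off `(0, ∞)`; the truncation has the same interference at every
  -- positive index.
  set p : ℝ → ℝ := (Ioi (0 : ℝ)).indicator q with hp
  have hp0 : ∀ t, 0 ≤ p t := fun t => indicator_nonneg hq0 t
  have hpi : Integrable p := (integrable_indicator_iff measurableSet_Ioi).2 hq
  have hpI : ∫ t, p t = ∫ t in Ioi (0 : ℝ), q t := integral_indicator measurableSet_Ioi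
  have hint : ∀ t ∈ Ioi (0 : ℝ), interference p t = interference q t := fun t ht =>
    setIntegral_congr_fun measurableSet_Ioi fun u hu => indicator_of_mem (lt_trans ht hu) q
  have hintmem : ∀ t ∈ Ioi (0 : ℝ), interference q t ∈ Icc 0 P := by
    intro t ht
    rw [← hint t ht]
    refine ⟨interference_nonneg hp0 t, ?_⟩
    have h3 := interference_add_integral_Iic hpi t
    have h4 : 0 ≤ ∫ u in Iic t, p u := integral_nonneg hp0
    linarith
  calc ∫⁻ t in Ioi (0 : ℝ), φ t
      ≤ ∫⁻ t in Ioi (0 : ℝ), ENNReal.ofReal (p t) * f (interference p t) := by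
        refine setLIntegral_mono' measurableSet_Ioi fun t ht => ?_
        refine (hφ t ht (σ (interference q t)) (hσmem _)
          ((hσ _).trans (hclamp _ (hintmem t ht)))).trans_eq ?_
        rw [hint t ht, hf, ← ENNReal.ofReal_mul (hp0 t), hp, indicator_of_mem ht, mul_comm]
    _ ≤ ∫⁻ t, ENNReal.ofReal (p t) * f (interference p t) := setLIntegral_le_lintegral _ _
    _ = ∫⁻ x in Icc 0 (∫ t, p t), f x := lintegral_comp_interference hp0 hpi hfm
    _ ≤ ∫⁻ x in Icc 0 P, f x :=
        lintegral_mono_set (Icc_subset_Icc_right (hpI.trans_le hqP))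
    _ = ∫⁻ s in Icc s₀ s₁, ENNReal.ofReal |-(2 * (3 + 2 * s - s ^ 2) / s ^ 4)| *
          f (thresholdPower s) := by
        rw [← himg]
        exact lintegral_image_eq_lintegral_abs_deriv_mul measurableSet_Icc
          (fun s hs => (hasDerivAt_thresholdPower (h0.trans_le hs.1)).hasDerivWithinAt)
          hanti.injOn f
    _ = ∫⁻ s in Icc s₀ s₁, ENNReal.ofReal (Real.exp (-s) * (3 / s + 2 - s)) := by
        refine setLIntegral_congr_fun measurableSet_Icc fun s hs => ?_
        simp only [hf]
        rw [hσT s hs, ← ENNReal.ofReal_mul (abs_nonneg _),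
          thresholdPower_mul_marginalRate (h0.trans_le hs.1) (hs.2.trans hs13)]
    _ = ENNReal.ofReal (rateFormula s₀ s₁) := lintegral_layer_rate h0 h01.le hs13

/-! ### Layered codes -/

lemma map_fading {Ω : Type*} [MeasurableSpace Ω] {μ : Measure Ω} [IsProbabilityMeasure μ]
    {h : Fin 2 → Ω → ℂ} (hlaw : ∀ i, HasLaw (h i) complexGaussian μ) (hindep : iIndepFun h μ) :
    HasLaw (fun ω i => h i ω) fadingLaw μ where
  aemeasurable := aemeasurable_pi_lambda _ fun i => (hlaw i).aemeasurable
  map_eq := by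
    rw [(iIndepFun_iff_map_fun_eq_pi_map fun i => (hlaw i).aemeasurable).1 hindep, fadingLaw]
    simp_rw [(hlaw _).map_eq]

lemma measure_fading_mem {Ω : Type*} [MeasurableSpace Ω] {μ : Measure Ω} {h : Fin 2 → Ω → ℂ}
    (hl : HasLaw (fun ω i => h i ω) fadingLaw μ) {A : Set (Fin 2 → ℂ)} (hA : MeasurableSet A) :
    μ {ω | (fun i => h i ω) ∈ A} = fadingLaw A := by
  rw [← hl.map_eq, Measure.map_apply_of_aemeasurable hl.aemeasurable hA]
  rfl

lemma continuous_receivedPower (Q : Matrix (Fin 2) (Fin 2) ℂ) :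
    Continuous fun z => receivedPower z Q := by
  unfold receivedPower
  exact Complex.continuous_re.comp
    (continuous_id.dotProduct (Continuous.matrix_mulVec continuous_const continuous_star))

lemma measurableSet_decodable (Q S : Matrix (Fin 2) (Fin 2) ℂ) (r : ℝ) :
    MeasurableSet {z | r ≤ receivedPower z Q / (1 + receivedPower z S)} :=
  measurableSet_le measurable_const ((continuous_receivedPower Q).measurable.div
    (measurable_const.add (continuous_receivedPower S).measurable))

lemma setIntegral_complex_nonneg {f : ℝ → ℂ} {A : Set ℝ} (hA : MeasurableSet A)
    (hf : ∀ t ∈ A, 0 ≤ f t) : 0 ≤ ∫ t in A, f t := by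
  have h : ∫ t in A, f t = ∫ t in A, (((f t).re : ℝ) : ℂ) :=
    setIntegral_congr_fun hA fun t ht => Complex.eq_re_of_ofReal_le (r := 0) (by simpa using hf t ht)
  rw [h, integral_complex_ofReal]
  have := setIntegral_nonneg (μ := volume) hA fun t ht => (Complex.le_def.1 (hf t ht)).1
  exact_mod_cast this

namespace ContinuousLayerCode

variable (c : ContinuousLayerCode)

lemma integrableOn_cov_Ioi {s : ℝ} (hs : 0 ≤ s) (i j : Fin 2) :
    IntegrableOn (fun t => c.cov t i j) (Ioi s) :=
  (c.cov_integrable i j).mono_set (Ioi_subset_Ioi hs)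

lemma upper_posSemidef {s : ℝ} (hs : 0 ≤ s) : (c.upper s).PosSemidef := by
  have hpos : ∀ t ∈ Ioi s, (c.cov t).PosSemidef := fun t ht => c.cov_posSemidef t (hs.trans_lt ht)
  refine PosSemidef.of_dotProduct_mulVec_nonneg ?_ fun x => ?_
  · ext i j
    simp only [conjTranspose_apply, upper, of_apply]
    rw [RCLike.star_def, ← integral_conj]
    exact setIntegral_congr_fun measurableSet_Ioi fun t ht => (hpos t ht).1.apply i j
  · have h : star x ⬝ᵥ (c.upper s *ᵥ x) = ∫ t in Ioi s, star x ⬝ᵥ (c.cov t *ᵥ x) := by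
      have hi : ∀ i j, Integrable (fun t => c.cov t i j) (volume.restrict (Ioi s)) :=
        c.integrableOn_cov_Ioi hs
      simp only [dotProduct, mulVec, Fin.sum_univ_two, upper, of_apply]
      have h2 : ∀ i, Integrable (fun t => c.cov t i 0 * x 0 + c.cov t i 1 * x 1)
          (volume.restrict (Ioi s)) := fun i => ((hi i 0).mul_const _).add ((hi i 1).mul_const _)
      rw [integral_add ((h2 0).const_mul _) ((h2 1).const_mul _), integral_const_mul,
        integral_const_mul, integral_add ((hi 0 0).mul_const _) ((hi 0 1).mul_const _),
        integral_add ((hi 1 0).mul_const _) ((hi 1 1).mul_const _),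
        integral_mul_const, integral_mul_const, integral_mul_const, integral_mul_const]
    rw [h]
    exact setIntegral_complex_nonneg measurableSet_Ioi fun t ht =>
      (hpos t ht).dotProduct_mulVec_nonneg x

lemma integrableOn_trace_cov : IntegrableOn (fun t => (c.cov t).trace.re) (Ioi 0) := by
  simp only [trace_fin_two, Complex.add_re]
  exact (c.cov_integrable 0 0).re.add (c.cov_integrable 1 1).re

lemma interference_trace_cov {s : ℝ} (hs : 0 ≤ s) :
    interference (fun t => (c.cov t).trace.re) s = (c.upper s).trace.re := by
  have h0 := c.integrableOn_cov_Ioi hs 0 0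
  have h1 := c.integrableOn_cov_Ioi hs 1 1
  simp only [interference, trace_fin_two, Complex.add_re, upper, of_apply]
  refine (integral_add h0.re h1.re).trans ?_
  congr 1
  · exact integral_re h0
  · exact integral_re h1

end ContinuousLayerCode

lemma sq_le_one_add {s s₁ : ℝ} (hs : 0 < s) (hs₁ : s ≤ s₁) (h1 : s₁ ^ 2 = 1 + s₁) :
    s ^ 2 ≤ 1 + s := by
  have : 1 ≤ s₁ := by nlinarith
  nlinarith

/-- Only the sum `P` of the two power constraints enters, as the price of a layer depends on traces
alone. -/
lemma expectedRate_le {s₀ s₁ P : ℝ} (h0 : 0 < s₀) (h01 : s₀ < s₁) (h1 : s₁ ^ 2 = 1 + s₁)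
    (hT : thresholdPower s₀ = P) {Ω : Type*} [MeasurableSpace Ω] {μ : Measure Ω}
    {h : Fin 2 → Ω → ℂ} (hl : HasLaw (fun ω i => h i ω) fadingLaw μ) (c : ContinuousLayerCode)
    (hc : ∀ i, c.power i ≤ P / 2) :
    c.expectedRate μ h ≤ ENNReal.ofReal (rateFormula s₀ s₁) := by
  refine lintegral_le_rateFormula h0 h01 h1 hT (q := fun t => (c.cov t).trace.re)
    (fun t ht => trace_re_nonneg (c.cov_posSemidef t ht)) c.integrableOn_trace_cov ?_ ?_
  · have h2 := c.interference_trace_cov le_rfl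
    rw [interference] at h2
    rw [h2, trace_fin_two, Complex.add_re]
    have h3 := hc 0
    have h4 := hc 1
    unfold ContinuousLayerCode.power at h3 h4
    linarith
  · intro t ht s hs hsT
    have ht0 : (0 : ℝ) ≤ t := le_of_lt ht
    rw [c.interference_trace_cov ht0] at hsT
    have hs0 : 0 < s := h0.trans_le hs.1
    have hm := measure_fading_mem hl
      (measurableSet_decodable (c.cov t) (c.upper t) (c.rate t))
    have := fadingLaw_decodable_mul_le (c.cov_posSemidef t ht) (c.upper_posSemidef ht0) hs0
      (sq_le_one_add hs0 hs.2 h1) hsT.symm (c.rate t)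
    rw [← hm] at this
    exact this

lemma measure_gain_tail {Ω : Type*} [MeasurableSpace Ω] {μ : Measure Ω}
    {h : Fin 2 → Ω → ℂ} (hl : HasLaw (fun ω i => h i ω) fadingLaw μ) {s : ℝ} (hs : 0 < s) :
    μ {ω | s ≤ ‖h 0 ω‖ ^ 2 + ‖h 1 ω‖ ^ 2} = ENNReal.ofReal ((1 + s) * Real.exp (-s)) := by
  have hA : MeasurableSet {z : Fin 2 → ℂ | s ≤ ‖z 0‖ ^ 2 + ‖z 1‖ ^ 2} :=
    measurableSet_le (by fun_prop) (by fun_prop)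
  rw [← fadingLaw_gain_tail hs, ← measure_fading_mem hl hA]
  rfl

/-- Here the matrix argument is not needed: with total density `2ρ`, the tangent bound at `l = 1/t`
has right side proportional to `1 + t I(t)`, which cancels the denominator of the layer's rate. -/
lemma layeredRate_le {s₀ s₁ P : ℝ} (h0 : 0 < s₀) (h01 : s₀ < s₁) (h1 : s₁ ^ 2 = 1 + s₁)
    (hT : thresholdPower s₀ = P) {Ω : Type*} [MeasurableSpace Ω] {μ : Measure Ω}
    {h : Fin 2 → Ω → ℂ} (hl : HasLaw (fun ω i => h i ω) fadingLaw μ) {ρ : ℝ → ℝ}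
    (hρ : IsPowerDistribution (P / 2) ρ) :
    layeredRate μ (fun ω => ‖h 0 ω‖ ^ 2 + ‖h 1 ω‖ ^ 2) ρ ≤
      ENNReal.ofReal (rateFormula s₀ s₁) := by
  obtain ⟨hρ0, hρi, hρP⟩ := hρ
  refine lintegral_le_rateFormula h0 h01 h1 hT (q := fun t => 2 * ρ t)
    (fun t ht => mul_nonneg zero_le_two (hρ0 t ht)) (hρi.const_mul 2) ?_ ?_
  · rw [integral_const_mul]
    linarith
  · intro t ht s hs hsT
    have ht0 : 0 < t := ht
    have hs0 : 0 < s := h0.trans_le hs.1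
    have hI : interference (fun t => 2 * ρ t) t = 2 * interference ρ t := integral_const_mul _ _
    rw [hI] at hsT
    have hI0 : 0 ≤ interference ρ t :=
      setIntegral_nonneg measurableSet_Ioi fun u hu => hρ0 u (ht0.trans hu)
    have hρt := hρ0 t ht
    have hg := gainTail_le (inv_pos.2 ht0) hs0 (sq_le_one_add hs0 hs.2 h1)
    rw [gainTail, if_pos (inv_pos.2 ht0), inv_inv, hsT] at hg
    have hd : 0 ≤ t * ρ t / (1 + t * interference ρ t) := by positivity
    rw [measure_gain_tail hl ht0, ← ENNReal.ofReal_mul (by positivity)]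
    apply ENNReal.ofReal_le_ofReal
    refine (mul_le_mul_of_nonneg_right hg hd).trans_eq ?_
    have : 1 + t * interference ρ t ≠ 0 := by positivity
    field_simp

/-- The optimal power distribution of a transmitter over the layers. -/
noncomputable def optimalDensity (s₀ s₁ : ℝ) : ℝ → ℝ :=
  (Ioc s₀ s₁).indicator fun s => (3 + 2 * s - s ^ 2) / s ^ 4

section OptimalDensity

variable {s₀ s₁ : ℝ}

lemma optimalDensity_nonneg (h0 : 0 < s₀) (h3 : s₁ ≤ 3) (s : ℝ) : 0 ≤ optimalDensity s₀ s₁ s := by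
  refine indicator_nonneg (fun s hs => ?_) s
  have hs0 : 0 < s := h0.trans hs.1
  have : 0 ≤ 3 + 2 * s - s ^ 2 := by nlinarith [hs.2]
  positivity

lemma measurable_optimalDensity : Measurable (optimalDensity s₀ s₁) :=
  (Measurable.div (by fun_prop) (by fun_prop)).indicator measurableSet_Ioc

lemma continuousOn_optimalDensity (h0 : 0 < s₀) :
    ContinuousOn (fun s : ℝ => (3 + 2 * s - s ^ 2) / s ^ 4) (Icc s₀ s₁) := by
  have : ∀ s ∈ Icc s₀ s₁, s ^ 4 ≠ 0 := fun s hs => pow_ne_zero 4 (h0.trans_le hs.1).ne'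
  fun_prop (disch := assumption)

lemma integrable_optimalDensity (h0 : 0 < s₀) : Integrable (optimalDensity s₀ s₁) :=
  (integrable_indicator_iff measurableSet_Ioc).2
    ((continuousOn_optimalDensity h0).integrableOn_Icc.mono_set Ioc_subset_Icc_self)

lemma integral_optimalDensity {s : ℝ} (h0 : 0 < s) (hs : s ≤ s₁) (h1 : s₁ ^ 2 = 1 + s₁) :
    ∫ t in Ioc s s₁, (3 + 2 * t - t ^ 2) / t ^ 4 = thresholdPower s / 2 := by
  -- The density is `-T'/2`, one half for each transmitter, and `T(s₁) = 0` removes the upper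
  -- endpoint.
  have hd : ∀ t ∈ uIcc s s₁, HasDerivAt (fun t => -(thresholdPower t / 2))
      ((3 + 2 * t - t ^ 2) / t ^ 4) t := by
    intro t ht
    rw [uIcc_of_le hs] at ht
    exact ((hasDerivAt_thresholdPower (h0.trans_le ht.1)).div_const 2).fun_neg.congr_deriv (by ring)
  have hc := continuousOn_optimalDensity (s₁ := s₁) h0
  rw [← intervalIntegral.integral_of_le hs, intervalIntegral.integral_eq_sub_of_hasDerivAt hd
    (ContinuousOn.intervalIntegrable (by rwa [uIcc_of_le hs]))]
  have : thresholdPower s₁ = 0 := by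
    rw [thresholdPower, h1]
    simp
  rw [this]
  ring

lemma interference_optimalDensity (h0 : 0 < s₀) (h1 : s₁ ^ 2 = 1 + s₁) {s : ℝ} (hs : s₀ ≤ s)
    (hs' : s ≤ s₁) : interference (optimalDensity s₀ s₁) s = thresholdPower s / 2 := by
  rw [interference, optimalDensity, setIntegral_indicator measurableSet_Ioc,
    ← integral_optimalDensity (h0.trans_le hs) hs' h1]
  congr 2
  ext t
  simp only [mem_inter_iff, mem_Ioi, mem_Ioc]
  exact ⟨fun h => ⟨h.1, h.2.2⟩, fun h => ⟨h.1, hs.trans_lt h.1, h.2⟩⟩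

lemma setIntegral_optimalDensity (h0 : 0 < s₀) (h01 : s₀ < s₁) (h1 : s₁ ^ 2 = 1 + s₁) :
    ∫ s in Ioi (0 : ℝ), optimalDensity s₀ s₁ s = thresholdPower s₀ / 2 := by
  rw [optimalDensity, setIntegral_indicator measurableSet_Ioc,
    ← integral_optimalDensity h0 h01.le h1]
  congr 2
  ext t
  simp only [mem_inter_iff, mem_Ioi, mem_Ioc]
  exact ⟨fun h => h.2, fun h => ⟨h0.trans h.1, h⟩⟩

lemma layeredRate_optimalDensity (h0 : 0 < s₀) (h01 : s₀ < s₁) (h1 : s₁ ^ 2 = 1 + s₁)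
    {Ω : Type*} [MeasurableSpace Ω] {μ : Measure Ω}
    {h : Fin 2 → Ω → ℂ} (hl : HasLaw (fun ω i => h i ω) fadingLaw μ) :
    layeredRate μ (fun ω => ‖h 0 ω‖ ^ 2 + ‖h 1 ω‖ ^ 2) (optimalDensity s₀ s₁) =
      ENNReal.ofReal (rateFormula s₀ s₁) := by
  have h3 : s₁ ≤ 3 := by nlinarith
  rw [← lintegral_layer_rate h0 h01.le h3, layeredRate, ← setLIntegral_congr Ioc_ae_eq_Icc,
    ← lintegral_indicator measurableSet_Ioc, ← lintegral_indicator measurableSet_Ioi]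
  refine lintegral_congr fun s => ?_
  by_cases hs : s ∈ Ioc s₀ s₁
  · have hs0 : 0 < s := h0.trans hs.1
    have hsI : s ∈ Ioi (0 : ℝ) := hs0
    rw [indicator_of_mem hs, indicator_of_mem hsI, measure_gain_tail hl hs0,
      interference_optimalDensity h0 h1 hs.1.le hs.2, optimalDensity, indicator_of_mem hs,
      ← ENNReal.ofReal_mul (by positivity)]
    congr 1
    -- The factor `1 + s` cancels the one in the tail probability.
    have h4 : 1 + s * (thresholdPower s / 2) = (1 + s) / s ^ 2 := by
      unfold thresholdPower
      field_simp
      ring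
    rw [h4]
    field_simp
  · rw [indicator_of_notMem hs]
    by_cases hsI : s ∈ Ioi (0 : ℝ)
    · rw [indicator_of_mem hsI, optimalDensity, indicator_of_notMem hs]
      simp
    · rw [indicator_of_notMem hsI]

end OptimalDensity

/-- The isotropic code whose layer `s` is designed for the channel gain `s`. -/
noncomputable def isotropicCode (ρ : ℝ → ℝ) (hρ0 : ∀ s, 0 ≤ ρ s) (hρm : Measurable ρ)
    (hρi : Integrable ρ) : ContinuousLayerCode where
  cov s := Matrix.diagonal fun _ => (ρ s : ℂ)
  rate s := (s * ρ s / (1 + s * interference ρ s)).toNNReal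
  cov_posSemidef s _ := PosSemidef.diagonal fun _ => by
    simpa using hρ0 s
  cov_integrable i j := by
    by_cases hij : i = j
    · subst hij
      simp only [diagonal_apply_eq]
      exact hρi.ofReal.integrableOn
    · simp [diagonal_apply_ne _ hij]
  rate_measurable := by
    have := (interference_continuous hρi).measurable
    fun_prop

lemma receivedPower_diagonal (z : Fin 2 → ℂ) (a : ℝ) :
    receivedPower z (Matrix.diagonal fun _ => (a : ℂ)) = a * (‖z 0‖ ^ 2 + ‖z 1‖ ^ 2) := by
  have := receivedPower_conj_diagonal z 1 (fun _ => a)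
  simp only [conjTranspose_one, Matrix.one_mul, Matrix.mul_one, vecMul_one] at this
  rw [this]
  ring

section IsotropicCode

variable {ρ : ℝ → ℝ} (hρ0 : ∀ s, 0 ≤ ρ s) (hρm : Measurable ρ) (hρi : Integrable ρ)

lemma isotropicCode_upper (s : ℝ) :
    (isotropicCode ρ hρ0 hρm hρi).upper s = Matrix.diagonal fun _ => (interference ρ s : ℂ) := by
  ext i j
  simp only [ContinuousLayerCode.upper, isotropicCode, of_apply]
  by_cases hij : i = j
  · subst hij
    simp only [diagonal_apply_eq]
    exact integral_complex_ofReal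
  · simp [diagonal_apply_ne _ hij]

lemma expectedRate_isotropicCode {Ω : Type*} [MeasurableSpace Ω] (μ : Measure Ω)
    (h : Fin 2 → Ω → ℂ) :
    (isotropicCode ρ hρ0 hρm hρi).expectedRate μ h =
      layeredRate μ (fun ω => ‖h 0 ω‖ ^ 2 + ‖h 1 ω‖ ^ 2) ρ := by
  refine setLIntegral_congr_fun measurableSet_Ioi fun s hs => ?_
  have hs0 : 0 < s := hs
  rcases (hρ0 s).eq_or_lt with h0 | h0
  -- Where the density vanishes the layer is always decodable, but its rate is zero, so the
  -- integrands agree although the events differ.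
  · simp [isotropicCode, ← h0]
  · have hI := interference_nonneg hρ0 s
    have hev : {ω | (isotropicCode ρ hρ0 hρm hρi).Decodable (fun i => h i ω) s} =
        {ω | s ≤ ‖h 0 ω‖ ^ 2 + ‖h 1 ω‖ ^ 2} := by
      ext ω
      simp only [mem_ofPred_eq, ContinuousLayerCode.Decodable, isotropicCode_upper]
      have hr : (((isotropicCode ρ hρ0 hρm hρi).rate s : ℝ≥0) : ℝ) =
          s * ρ s / (1 + s * interference ρ s) := Real.coe_toNNReal _ (by positivity)
      have hc : (isotropicCode ρ hρ0 hρm hρi).cov s = Matrix.diagonal fun _ => (ρ s : ℂ) := rfl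
      rw [hr, hc, receivedPower_diagonal, receivedPower_diagonal]
      set a := ‖h 0 ω‖ ^ 2 + ‖h 1 ω‖ ^ 2
      have ha : 0 ≤ a := by positivity
      -- The comparison is between `x/(1 + xI)` at `s` and at the actual gain `a`; this function is
      -- strictly increasing for `x ≥ 0`.
      rw [div_le_div_iff₀ (by positivity) (by positivity)]
      constructor
      · intro hle
        nlinarith
      · intro hle
        nlinarith
    rw [hev]
    rfl

end IsotropicCode

/-! ### The ergodic capacity -/

lemma integral_exp_neg_div_add {p : ℝ} (hp : 0 < p) :
    ∫ t in Ioi (0 : ℝ), Real.exp (-t) / (1 + p * t) = p⁻¹ * Real.exp p⁻¹ * E₁ p⁻¹ := by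
  have h := (measurePreserving_add_right volume p⁻¹).setIntegral_preimage_emb
    (measurableEmbedding_addRight p⁻¹) (fun u => Real.exp (-u) / u) (Ioi p⁻¹)
  have hpre : (fun x => x + p⁻¹) ⁻¹' Ioi p⁻¹ = Ioi (0 : ℝ) := by
    ext x
    simp
  rw [hpre] at h
  rw [E₁, ← h, ← integral_const_mul]
  refine setIntegral_congr_fun measurableSet_Ioi fun t ht => ?_
  have ht0 : 0 < t := ht
  have h1 : Real.exp (-t) = Real.exp p⁻¹ * Real.exp (-(t + p⁻¹)) := by
    rw [← Real.exp_add]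
    ring_nf
  have h2 : 1 + p * t = p * (t + p⁻¹) := by field_simp; ring
  rw [h1, h2]
  field_simp

lemma integrableOn_exp_neg_div_add {p : ℝ} (hp : 0 < p) :
    IntegrableOn (fun t => Real.exp (-t) / (1 + p * t)) (Ioi 0) := by
  have hm : Measurable fun t : ℝ => Real.exp (-t) / (1 + p * t) :=
    Measurable.div (by fun_prop) (by fun_prop)
  refine Integrable.mono' (integrableOn_exp_neg_Ioi 0) hm.aestronglyMeasurable ?_
  refine (ae_restrict_iff' measurableSet_Ioi).2 (ae_of_all _ fun t ht => ?_)
  have ht0 : 0 < t := ht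
  rw [Real.norm_of_nonneg (by positivity)]
  exact div_le_self (Real.exp_pos _).le (by nlinarith)

lemma integral_inv_affine {p x : ℝ} (hp : 0 < p) (hx : 0 ≤ x) :
    ∫ t in (0 : ℝ)..x, p / (1 + p * t) = Real.log (1 + p * x) := by
  have hpos : ∀ t ∈ uIcc 0 x, 0 < 1 + p * t := by
    intro t ht
    rw [uIcc_of_le hx] at ht
    have := ht.1
    positivity
  have hd : ∀ t ∈ uIcc 0 x, HasDerivAt (fun t => Real.log (1 + p * t)) (p / (1 + p * t)) t := by
    intro t ht
    have h1 : HasDerivAt (fun t => 1 + p * t) p t := by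
      simpa using ((hasDerivAt_id t).const_mul p).const_add 1
    exact h1.log (hpos t ht).ne'
  rw [intervalIntegral.integral_eq_sub_of_hasDerivAt hd]
  · simp
  · apply ContinuousOn.intervalIntegrable
    have : ∀ t ∈ uIcc 0 x, 1 + p * t ≠ 0 := fun t ht => (hpos t ht).ne'
    fun_prop (disch := assumption)

lemma isotropic_rate_integrand {p t : ℝ} (hp : 0 < p) (ht : 0 < t) :
    Real.exp (-t) + (p - 1) * (Real.exp (-t) / (1 + p * t)) =
      (1 + t) * Real.exp (-t) * (p / (1 + p * t)) := by
  field_simp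
  ring

lemma integrableOn_isotropic_rate {p : ℝ} (hp : 0 < p) :
    IntegrableOn (fun t => Real.exp (-t) + (p - 1) * (Real.exp (-t) / (1 + p * t))) (Ioi 0) :=
  (integrableOn_exp_neg_Ioi 0).add ((integrableOn_exp_neg_div_add hp).const_mul (p - 1))

lemma integral_isotropic_rate {p : ℝ} (hp : 0 < p) :
    ∫ t in Ioi (0 : ℝ), (Real.exp (-t) + (p - 1) * (Real.exp (-t) / (1 + p * t))) =
      1 + (1 - p⁻¹) * Real.exp p⁻¹ * E₁ p⁻¹ := by
  rw [integral_add (integrableOn_exp_neg_Ioi 0)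
    ((integrableOn_exp_neg_div_add hp).const_mul (p - 1)), integral_const_mul,
    integral_exp_neg_div_add hp, integral_exp_neg_Ioi_zero]
  field_simp

lemma isotropic_rate_integrand_nonneg {p t : ℝ} (hp : 0 < p) (ht : 0 < t) :
    0 ≤ Real.exp (-t) + (p - 1) * (Real.exp (-t) / (1 + p * t)) := by
  rw [isotropic_rate_integrand hp ht]
  positivity

/-- The ergodic rate of isotropic inputs of power `p` per transmitter. -/
lemma lintegral_log_isotropic {p : ℝ} (hp : 0 < p) :
    ∫⁻ z, ENNReal.ofReal (Real.log (1 + p * (‖z 0‖ ^ 2 + ‖z 1‖ ^ 2))) ∂fadingLaw =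
      ENNReal.ofReal (1 + (1 - p⁻¹) * Real.exp p⁻¹ * E₁ p⁻¹) := by
  -- Layer-cake formula: the mean of `ln(1 + p a)` is the integral of `Pr {a ≥ t}` against its
  -- derivative `p/(1 + p t)`.
  have hlc := lintegral_comp_eq_lintegral_meas_le_mul fadingLaw
    (f := fun z => ‖z 0‖ ^ 2 + ‖z 1‖ ^ 2) (g := fun t => p / (1 + p * t))
    (ae_of_all _ fun z => by positivity) (by fun_prop)
    (fun t ht => by
      apply ContinuousOn.intervalIntegrable
      have : ∀ u ∈ uIcc 0 t, 1 + p * u ≠ 0 := by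
        intro u hu
        rw [uIcc_of_le ht.le] at hu
        have := hu.1
        positivity
      fun_prop (disch := assumption))
    ((ae_restrict_iff' measurableSet_Ioi).2 (ae_of_all _ fun t ht => by
      have ht0 : 0 < t := ht
      positivity))
  have h1 : ∀ z : Fin 2 → ℂ, ∫ t in (0 : ℝ)..(‖z 0‖ ^ 2 + ‖z 1‖ ^ 2), p / (1 + p * t) =
      Real.log (1 + p * (‖z 0‖ ^ 2 + ‖z 1‖ ^ 2)) := fun z => integral_inv_affine hp (by positivity)
  simp_rw [h1] at hlc
  rw [hlc]
  rw [← integral_isotropic_rate hp,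
    ofReal_integral_eq_lintegral_ofReal (integrableOn_isotropic_rate hp)
      ((ae_restrict_iff' measurableSet_Ioi).2 (ae_of_all _ fun t ht =>
        isotropic_rate_integrand_nonneg hp ht))]
  refine setLIntegral_congr_fun measurableSet_Ioi fun t ht => ?_
  have ht0 : 0 < t := ht
  rw [fadingLaw_gain_tail ht0, ← ENNReal.ofReal_mul (by positivity),
    isotropic_rate_integrand hp ht0]

lemma log_add_log_le {a b : ℝ} (ha : 0 < a) (hb : 0 < b) :
    Real.log a + Real.log b ≤ 2 * Real.log ((a + b) / 2) := by
  rw [← Real.log_mul ha.ne' hb.ne', ← Nat.cast_two, ← Real.log_pow]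
  apply Real.log_le_log (by positivity)
  push_cast
  nlinarith [sq_nonneg (a - b)]

lemma flip_mul_conjTranspose :
    (!![1, 0; 0, -1] : Matrix (Fin 2) (Fin 2) ℂ) * (!![1, 0; 0, -1] : Matrix _ _ ℂ)ᴴ = 1 := by
  ext i j
  fin_cases i <;> fin_cases j <;> simp [Matrix.mul_apply]

lemma vecMul_flip (z : Fin 2 → ℂ) : z ᵥ* !![1, 0; 0, -1] = ![z 0, -z 1] := by
  ext i
  fin_cases i <;> simp [vecMul, dotProduct]

/-- Averaging the received power over the swap and the sign flip of the coefficients. -/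
lemma receivedPower_average (z : Fin 2 → ℂ) (Q : Matrix (Fin 2) (Fin 2) ℂ) :
    receivedPower z Q + receivedPower ![z 0, -z 1] Q +
      (receivedPower ![z 1, z 0] Q + receivedPower ![z 1, -z 0] Q) =
      2 * Q.trace.re * (‖z 0‖ ^ 2 + ‖z 1‖ ^ 2) := by
  simp only [receivedPower, dotProduct, mulVec, Fin.sum_univ_two, Pi.star_apply, cons_val_zero,
    cons_val_one, RCLike.star_def, trace_fin_two, ← Complex.normSq_eq_norm_sq,
    Complex.normSq_apply]
  simp
  ring

lemma lintegral_fadingLaw_vecMul {V : Matrix (Fin 2) (Fin 2) ℂ} (hV : V * Vᴴ = 1)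
    {f : (Fin 2 → ℂ) → ℝ≥0∞} (hf : Measurable f) :
    ∫⁻ z, f (z ᵥ* V) ∂fadingLaw = ∫⁻ z, f z ∂fadingLaw := by
  have hm : Measurable fun z : Fin 2 → ℂ => z ᵥ* V :=
    (Continuous.matrix_vecMul continuous_id continuous_const).measurable
  conv_rhs => rw [← map_vecMul_fadingLaw hV, lintegral_map hf hm]

lemma mutualInformation_nonneg {Q : Matrix (Fin 2) (Fin 2) ℂ} (hQ : Q.PosSemidef)
    (z : Fin 2 → ℂ) : 0 ≤ mutualInformation z Q :=
  Real.log_nonneg (by linarith [receivedPower_nonneg hQ z])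

lemma measurable_mutualInformation (Q : Matrix (Fin 2) (Fin 2) ℂ) :
    Measurable fun z => mutualInformation z Q :=
  Real.measurable_log.comp (measurable_const.add (continuous_receivedPower Q).measurable)

/-- The sign flip and the swap preserve the law, so the mean equals the mean of the average over the
four resulting vectors. Concavity of the logarithm bounds that average by the logarithm at the
averaged received power, which depends on `Q` only through its trace. -/
lemma lintegral_mutualInformation_le {Q : Matrix (Fin 2) (Fin 2) ℂ} (hQ : Q.PosSemidef) {p : ℝ}
    (hp : Q.trace.re ≤ 2 * p) :
    ∫⁻ z, ENNReal.ofReal (mutualInformation z Q) ∂fadingLaw ≤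
      ∫⁻ z, ENNReal.ofReal (Real.log (1 + p * (‖z 0‖ ^ 2 + ‖z 1‖ ^ 2))) ∂fadingLaw := by
  set f : (Fin 2 → ℂ) → ℝ≥0∞ := fun z => ENNReal.ofReal (mutualInformation z Q) with hf
  have hfm : Measurable f := (measurable_mutualInformation Q).ennreal_ofReal
  have hF : ∀ z, f z + f ![z 0, -z 1] + (f ![z 1, z 0] + f ![z 1, -z 0]) ≤
      4 * ENNReal.ofReal (Real.log (1 + p * (‖z 0‖ ^ 2 + ‖z 1‖ ^ 2))) := by
    intro z
    have hn : ∀ y, 0 ≤ mutualInformation y Q := mutualInformation_nonneg hQ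
    have hr : ∀ y, 0 < 1 + receivedPower y Q := fun y => by linarith [receivedPower_nonneg hQ y]
    simp only [hf]
    rw [← ENNReal.ofReal_add (hn _) (hn _), ← ENNReal.ofReal_add (hn _) (hn _),
      ← ENNReal.ofReal_add (add_nonneg (hn _) (hn _)) (add_nonneg (hn _) (hn _)),
      show (4 : ℝ≥0∞) = ENNReal.ofReal 4 by simp, ← ENNReal.ofReal_mul (by norm_num)]
    apply ENNReal.ofReal_le_ofReal
    unfold mutualInformation
    have h1 := log_add_log_le (hr z) (hr ![z 0, -z 1])
    have h2 := log_add_log_le (hr ![z 1, z 0]) (hr ![z 1, -z 0])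
    have h3 := log_add_log_le (half_pos (add_pos (hr z) (hr ![z 0, -z 1])))
      (half_pos (add_pos (hr ![z 1, z 0]) (hr ![z 1, -z 0])))
    have h4 : Real.log (((1 + receivedPower z Q + (1 + receivedPower ![z 0, -z 1] Q)) / 2 +
        (1 + receivedPower ![z 1, z 0] Q + (1 + receivedPower ![z 1, -z 0] Q)) / 2) / 2) ≤
        Real.log (1 + p * (‖z 0‖ ^ 2 + ‖z 1‖ ^ 2)) := by
      have := receivedPower_average z Q
      have h5 := hr z
      have h6 := hr ![z 0, -z 1]
      have h7 := hr ![z 1, z 0]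
      have h8 := hr ![z 1, -z 0]
      apply Real.log_le_log (by positivity)
      have h9 : 0 ≤ ‖z 0‖ ^ 2 + ‖z 1‖ ^ 2 := by positivity
      nlinarith
    linarith
  have hflip := lintegral_fadingLaw_vecMul flip_mul_conjTranspose hfm
  have hswap := lintegral_fadingLaw_vecMul swap_mul_conjTranspose hfm
  have hg : Measurable fun z : Fin 2 → ℂ => f (z ᵥ* !![1, 0; 0, -1]) :=
    hfm.comp (Continuous.matrix_vecMul continuous_id continuous_const).measurable
  have hboth := (lintegral_fadingLaw_vecMul swap_mul_conjTranspose hg).trans hflip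
  simp only [vecMul_flip, vecMul_swap, cons_val_zero, cons_val_one] at hflip hswap hboth
  have hm1 : Measurable fun z : Fin 2 → ℂ => f ![z 0, -z 1] := by simpa only [vecMul_flip] using hg
  have hm2 : Measurable fun z : Fin 2 → ℂ => f ![z 1, z 0] := by
    have : Measurable fun z : Fin 2 → ℂ => f (z ᵥ* !![0, 1; 1, 0]) :=
      hfm.comp (Continuous.matrix_vecMul continuous_id continuous_const).measurable
    simpa only [vecMul_swap] using this
  have hm3 : Measurable fun z : Fin 2 → ℂ => f z + f ![z 0, -z 1] := hfm.add hm1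
  have hsum := lintegral_mono (μ := fadingLaw) hF
  rw [lintegral_add_left hm3, lintegral_add_left hfm, lintegral_add_left hm2, hflip,
    hswap, hboth, lintegral_const_mul' _ _ (by norm_num)] at hsum
  have h4 : ∫⁻ z, f z ∂fadingLaw + ∫⁻ z, f z ∂fadingLaw +
      (∫⁻ z, f z ∂fadingLaw + ∫⁻ z, f z ∂fadingLaw) = 4 * ∫⁻ z, f z ∂fadingLaw := by ring
  rw [h4] at hsum
  exact (ENNReal.mul_le_mul_iff_right (by norm_num) (by norm_num)).1 hsum

lemma ergodic_capacity {Ω : Type*} [MeasurableSpace Ω] {μ : Measure Ω} {h : Fin 2 → Ω → ℂ}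
    (hl : HasLaw (fun ω i => h i ω) fadingLaw μ) {p : ℝ} (hp : 0 < p) :
    IsGreatest
      {C : ℝ | ∃ Q : Matrix (Fin 2) (Fin 2) ℂ, IsAdmissibleCov p Q ∧
        C = ∫ ω, mutualInformation (fun i => h i ω) Q ∂μ}
      (1 + (1 - p⁻¹) * Real.exp p⁻¹ * E₁ p⁻¹) := by
  have hint : ∀ Q : Matrix (Fin 2) (Fin 2) ℂ, Q.PosSemidef →
      ∫ ω, mutualInformation (fun i => h i ω) Q ∂μ =
        (∫⁻ z, ENNReal.ofReal (mutualInformation z Q) ∂fadingLaw).toReal := by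
    intro Q hQ
    rw [← integral_eq_lintegral_of_nonneg_ae (ae_of_all _ (mutualInformation_nonneg hQ))
      (measurable_mutualInformation Q).aestronglyMeasurable, ← hl.map_eq,
      integral_map hl.aemeasurable (measurable_mutualInformation Q).aestronglyMeasurable]
  have hval := lintegral_log_isotropic hp
  have hpos : 0 ≤ 1 + (1 - p⁻¹) * Real.exp p⁻¹ * E₁ p⁻¹ := by
    rw [← integral_isotropic_rate hp]
    exact setIntegral_nonneg measurableSet_Ioi fun t ht => isotropic_rate_integrand_nonneg hp ht
  constructor
  · have hQ : (Matrix.diagonal fun _ : Fin 2 => (p : ℂ)).PosSemidef :=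
      PosSemidef.diagonal fun _ => by simpa using hp.le
    refine ⟨_, ⟨hQ, fun i => by simp⟩, ?_⟩
    rw [hint _ hQ]
    simp only [mutualInformation, receivedPower_diagonal]
    rw [hval, ENNReal.toReal_ofReal hpos]
  · rintro C ⟨Q, ⟨hQ, hQp⟩, rfl⟩
    rw [hint _ hQ, ← ENNReal.toReal_ofReal hpos, ← hval]
    refine ENNReal.toReal_mono (hval ▸ ENNReal.ofReal_ne_top)
      (lintegral_mutualInformation_le hQ ?_)
    rw [trace_fin_two, Complex.add_re]
    linarith [hQp 0, hQp 1]

end DistributedAntenna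

open DistributedAntenna in
theorem mainTheorem12 {Ω : Type*} [MeasurableSpace Ω] (μ : Measure Ω) [IsProbabilityMeasure μ]
    (h : Fin 2 → Ω → ℂ) (hlaw : ∀ i, HasLaw (h i) complexGaussian μ) (hindep : iIndepFun h μ)
    (P : ℝ) (hP : 0 < P) :
    (∃ s₀ s₁ : ℝ, (s₀ : ℂ) = cardanoS₀ P ∧ s₁ = (1 + √5) / 2 ∧ 0 < s₀ ∧ s₀ < s₁ ∧
      IsGreatest
        {R : ℝ≥0∞ | ∃ c : ContinuousLayerCode,
          (∀ i, c.power i ≤ P / 2) ∧ R = c.expectedRate μ h}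
        (ENNReal.ofReal (rateFormula s₀ s₁)) ∧
      IsGreatest
        {R : ℝ≥0∞ | ∃ ρ : ℝ → ℝ, IsPowerDistribution (P / 2) ρ ∧
          R = layeredRate μ (fun ω => ‖h 0 ω‖ ^ 2 + ‖h 1 ω‖ ^ 2) ρ}
        (ENNReal.ofReal (rateFormula s₀ s₁))) ∧
    IsGreatest
      {C : ℝ | ∃ Q : Matrix (Fin 2) (Fin 2) ℂ, IsAdmissibleCov (P / 2) Q ∧
        C = ∫ ω, mutualInformation (fun i => h i ω) Q ∂μ}
      (1 + (1 - 2 / P) * Real.exp (2 / P) * E₁ (2 / P)) := by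
  have hl := map_fading hlaw hindep
  refine ⟨?_, ?_⟩
  · obtain ⟨s₀, hs₀, h0, hcub⟩ := exists_real_cardanoS₀ hP
    have h5 : √5 ^ 2 = 5 := Real.sq_sqrt (by norm_num)
    have h5' : 0 ≤ √5 := Real.sqrt_nonneg 5
    set s₁ : ℝ := (1 + √5) / 2 with hs₁
    have h1 : s₁ ^ 2 = 1 + s₁ := by rw [hs₁]; linarith
    have h1' : 0 < s₁ := by positivity
    -- The cubic gives `1 + s₀ - s₀² > 0`, so `s₀` lies below the golden ratio.
    have h01 : s₀ < s₁ := by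
      have hpos : 0 < P * s₀ ^ 3 := by positivity
      by_contra hcon
      nlinarith
    have hT : thresholdPower s₀ = P := by
      rw [thresholdPower, div_eq_iff (by positivity), hcub]
    have h3 : s₁ ≤ 3 := by nlinarith
    have hρ0 := optimalDensity_nonneg (s₁ := s₁) h0 h3
    have hρi := integrable_optimalDensity (s₁ := s₁) h0
    have hρI := setIntegral_optimalDensity h0 h01 h1
    have hrate := layeredRate_optimalDensity h0 h01 h1 hl
    refine ⟨s₀, s₁, hs₀, rfl, h0, h01, ⟨?_, ?_⟩, ⟨?_, ?_⟩⟩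
    · refine ⟨isotropicCode _ hρ0 measurable_optimalDensity hρi, fun i => ?_, ?_⟩
      · rw [ContinuousLayerCode.power, isotropicCode_upper, diagonal_apply_eq, Complex.ofReal_re,
          interference, hρI, hT]
      · rw [expectedRate_isotropicCode, hrate]
    · rintro R ⟨c, hc, rfl⟩
      exact expectedRate_le h0 h01 h1 hT hl c hc
    · exact ⟨_, ⟨fun s _ => hρ0 s, hρi.integrableOn, (hρI.trans (by rw [hT])).le⟩, hrate.symm⟩
    · rintro R ⟨ρ, hρ, rfl⟩
      exact layeredRate_le h0 h01 h1 hT hl hρ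
  · have := ergodic_capacity hl (half_pos hP)
    rwa [inv_div] at this
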